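/- Let $R_0>0$, $S^1=\mathbb R/2\pi\mathbb Z$ with Lebesgue measure $d\theta$ (total mass $2\pi$), and let $U,A\in C([R_0,\infty);H^1(S^1))\cap C^1([R_0,\infty);L^2(S^1))$ be a weak solution of the essential Gowdy equations, that is, in the sense of distributions on $(R_0,\infty)\times S^1$, $$(R\,U_R)_R-(R\,U_\theta)_\theta = 2R\,\Omega^U,\qquad (R^{-1}A_R)_R-(R^{-1}A_\theta)_\theta = e^{-2U}\,\Omega^A,$$ where $$\Omega^U=\frac{e^{4U}}{4R^2}\,(A_R^2-A_\theta^2),\qquad \Omega^A=\frac{4e^{2U}}{R}\,(-U_RA_R+U_\theta A_\theta).$$ For $b\in\mathbb R$ and $R\ge R_0$ define $$\mathscr E^A(R)=\int_{S^1}\frac{e^{4U}}{4R^2}\,(A_R^2+A_\theta^2)\,d\theta,\qquad \mathscr E(R)=\int_{S^1}\big(U_R^2+U_\theta^2\big)\,d\theta+\mathscr E^A(R),$$ $$\mathscr E_b(R)=\int_{S^1}\Big(\big(U_R-bR^{-1}\big)^2+U_\theta^2\Big)\,d\theta+\mathscr E^A(R).$$ Then, for every $b\in[0,1/2]$, the integrand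 defining $\mathscr E_b(R)$ is integrable over $S^1$ for every $R\ge R_0$, the function $R\mapsto \mathscr E_b(R)$ is non-increasing on $[R_0,\infty)$, and $$\int_{R_0}^{\infty}\frac2R\int_{S^1}\frac{e^{4U}}{4R^2}\,\big(2b\,A_R^2+(1-2b)\,A_\theta^2\big)\,d\theta\,dR\ \le\ \mathscr E_b(R_0)+b^2\,\mathscr E(R_0),$$ where the integral in $R$ converges. In particular, $R\mapsto \mathscr E^A(R)/R$ is integrable on $(R_0,\infty)$. -/

import Mathlib

open Real Set MeasureTheory
open scoped ContDiff

namespace Gowdy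

noncomputable section

/-- The circle `S¹ = ℝ / 2πℤ`; its Lebesgue measure `volume` has total mass `2π`. -/
abbrev S1 : Type := AddCircle (2 * π)

instance instFactTwoPi : Fact (0 < 2 * π) := ⟨Real.two_pi_pos⟩

/-- The Hilbert space `L²(S¹)` of real square-integrable functions with respect to `dθ`. -/
abbrev L2S1 : Type := Lp ℝ 2 (volume : Measure S1)

/-- Classical derivative `φ_θ` of a function on the circle. -/
def dTheta (φ : S1 → ℝ) (θ : S1) : ℝ :=
  deriv (fun t : ℝ => φ (θ + (t : S1))) 0

/-- `w ∈ L²(S¹)` is the weak derivative of `u ∈ L²(S¹)`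
(so that `u ∈ H¹(S¹)` with `‖u‖²_{H¹} = ‖u‖² + ‖w‖²`). -/
def HasWeakDeriv (u w : L2S1) : Prop :=
  ∀ φ : S1 → ℝ, ContDiff ℝ ∞ (fun t : ℝ => φ (t : S1)) →
    ∫ θ : S1, u θ * dTheta φ θ = - ∫ θ : S1, w θ * φ θ

/-- An element of `C([R₀,∞); H¹(S¹)) ∩ C¹([R₀,∞); L²(S¹))`, together with its first derivatives
`dR` (strong derivative in `L²(S¹)` with respect to `R`, one-sided at `R₀`) and
`dθ` (weak derivative in `θ`). -/
structure Field (R₀ : ℝ) where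
  /-- the coefficient `R ↦ u(R, ·)` -/
  val : ℝ → L2S1
  /-- `R ↦ u_R(R, ·)` -/
  dR : ℝ → L2S1
  /-- `R ↦ u_θ(R, ·)` -/
  dθ : ℝ → L2S1
  continuousOn_val : ContinuousOn val (Ici R₀)
  continuousOn_dθ : ContinuousOn dθ (Ici R₀)
  hasWeakDeriv : ∀ R ∈ Ici R₀, HasWeakDeriv (val R) (dθ R)
  hasDerivWithinAt : ∀ R ∈ Ici R₀, HasDerivWithinAt val (dR R) (Ici R₀) R
  continuousOn_dR : ContinuousOn dR (Ici R₀)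

/-- Test functions: smooth functions on `(R₀,∞) × S¹` with compact support. -/
structure IsTestFunction (R₀ : ℝ) (φ : ℝ → S1 → ℝ) : Prop where
  smooth : ContDiff ℝ ∞ (fun p : ℝ × ℝ => φ p.1 (p.2 : S1))
  support : ∃ a b : ℝ, R₀ < a ∧ ∀ R, R ∉ Icc a b → ∀ θ, φ R θ = 0

variable {R₀ : ℝ}

/-- `Ω^U = e^{4U}/(4R²) (A_R² - A_θ²)`. -/
def OmegaU (U A : Field R₀) (R : ℝ) (θ : S1) : ℝ :=
  exp (4 * U.val R θ) / (4 * R ^ 2) * ((A.dR R θ) ^ 2 - (A.dθ R θ) ^ 2)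

/-- `Ω^A = 4 e^{2U}/R (- U_R A_R + U_θ A_θ)`. -/
def OmegaA (U A : Field R₀) (R : ℝ) (θ : S1) : ℝ :=
  4 * exp (2 * U.val R θ) / R * (- (U.dR R θ * A.dR R θ) + U.dθ R θ * A.dθ R θ)

/-- `(R U_R)_R - (R U_θ)_θ = 2 R Ω^U` in the sense of distributions on `(R₀,∞) × S¹`. -/
def WeakEquationU (U A : Field R₀) : Prop :=
  ∀ φ : ℝ → S1 → ℝ, IsTestFunction R₀ φ →
    ∫ R in Ioi R₀, ∫ θ : S1,
        (- (R * U.dR R θ) * deriv (fun r => φ r θ) R + R * U.dθ R θ * dTheta (φ R) θ)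
      = ∫ R in Ioi R₀, ∫ θ : S1, 2 * R * OmegaU U A R θ * φ R θ

/-- `(R⁻¹ A_R)_R - (R⁻¹ A_θ)_θ = e^{-2U} Ω^A` in the sense of distributions on
`(R₀,∞) × S¹`. -/
def WeakEquationA (U A : Field R₀) : Prop :=
  ∀ φ : ℝ → S1 → ℝ, IsTestFunction R₀ φ →
    ∫ R in Ioi R₀, ∫ θ : S1,
        (- (R⁻¹ * A.dR R θ) * deriv (fun r => φ r θ) R + R⁻¹ * A.dθ R θ * dTheta (φ R) θ)
      = ∫ R in Ioi R₀, ∫ θ : S1, exp (-2 * U.val R θ) * OmegaA U A R θ * φ R θ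

/-- Density of the energy of `A`: `e^{4U}/(4R²) (A_R² + A_θ²)`. -/
def densityA (U A : Field R₀) (R : ℝ) (θ : S1) : ℝ :=
  exp (4 * U.val R θ) / (4 * R ^ 2) * ((A.dR R θ) ^ 2 + (A.dθ R θ) ^ 2)

/-- Energy of `A`. -/
def energyA (U A : Field R₀) (R : ℝ) : ℝ :=
  ∫ θ : S1, densityA U A R θ

/-- The natural energy `∫ U_R² + U_θ² + e^{4U}/(4R²) (A_R² + A_θ²) dθ`. -/
def energy (U A : Field R₀) (R : ℝ) : ℝ :=
  ∫ θ : S1, ((U.dR R θ) ^ 2 + (U.dθ R θ) ^ 2 + densityA U A R θ)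

/-- Density of the `A`-effective energy:
`(U_R - b/R)² + U_θ² + e^{4U}/(4R²) (A_R² + A_θ²)`. -/
def effectiveDensity (b : ℝ) (U A : Field R₀) (R : ℝ) (θ : S1) : ℝ :=
  (U.dR R θ - b * R⁻¹) ^ 2 + (U.dθ R θ) ^ 2 + densityA U A R θ

/-- The `A`-effective energy with parameter `b`. -/
def effectiveEnergy (b : ℝ) (U A : Field R₀) (R : ℝ) : ℝ :=
  ∫ θ : S1, effectiveDensity b U A R θ

/-- The dissipation `(2/R) ∫ e^{4U}/(4R²) (2b A_R² + (1-2b) A_θ²) dθ`. -/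
def dissipation (b : ℝ) (U A : Field R₀) (R : ℝ) : ℝ :=
  2 / R * ∫ θ : S1, exp (4 * U.val R θ) / (4 * R ^ 2) *
    (2 * b * (A.dR R θ) ^ 2 + (1 - 2 * b) * (A.dθ R θ) ^ 2)

end

end Gowdy

/-!
The energy identity for weak solutions of the Gowdy equations.

For smooth solutions a direct computation gives
`d/dR E_b = -(2/R) ∫ (U_R - b/R)² dθ - D_b(R)`, where `D_b` is the dissipation; everything claimed
follows from this identity, since for `0 ≤ b ≤ 1/2` both terms on the right have a sign, and for
`b = 1/4` the dissipation is `E^A / R`. The difficulty is that for weak solutions the source terms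
are only in `L¹` of a circle, so that they cannot be multiplied by `U_R` and `A_R`, which are only in
`L²`.

This is overcome by working along characteristics. Let `σ = ±1`, so that `∂_R - σ ∂_θ`
differentiates along the lines `θ + σR = c`. The quantities `X = R (U_R + σ U_θ)`,
`Z = R⁻¹ (A_R + σ A_θ)` and `U` have, in the sense of distributions, integrable derivatives in this
direction (`WeakWave.transport`, `Field.transport_val`). Testing with functions `χ(R) ψ(θ + σR)`
and using Fubini's theorem, one finds that for almost every `c` they are absolutely continuous along
the characteristic (`ae_sub_eq_integral_of_transport`, `ae_ae_sub_eq_integral`). On such a line the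
ordinary chain rule applies to the null energy density
`(U_R + σ U_θ - b/R)² + e^{4U}/(4R²) (A_R + σ A_θ)² = R⁻² (X - b)² + e^{4U} Z² / 4`.
The cubic terms cancel pointwise (`nullEnergy_sub_eq_integral_nullLoss`), and the remaining quadratic
expression is integrable on `[R₁, R₂] × S¹`; hence the identity can be integrated over `c`
(`integral_nullEnergy_sub`). Half the sum over `σ = 1` and `σ = -1` is the energy identity
(`effectiveEnergy_sub`).

Two auxiliary facts are needed throughout. A continuous curve in `L²(S¹)` has a jointly measurable
version (`exists_isVersion`), which makes Fubini's theorem available. And `U` is locally bounded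
(`HasWeakDeriv.ae_abs_le`), so that the exponential weights are harmless; this Sobolev inequality is
itself an instance of the transport argument.
-/

namespace Gowdy

open Filter Topology

/-! ### Jointly measurable versions of curves in `L²(S¹)` -/

/-- `F` is a jointly measurable version, on `[R₀, ∞) × S¹`, of the curve `f` in `L²(S¹)`. -/
structure IsVersion (R₀ : ℝ) (f : ℝ → L2S1) (F : ℝ → S1 → ℝ) : Prop where
  measurable : Measurable (Function.uncurry F)
  ae_eq : ∀ R ∈ Ici R₀, F R =ᵐ[volume] f R

/-- If `g n → x` in `L²` faster than a geometric series then `g n → x` almost everywhere. -/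
lemma ae_tendsto_of_dist_lt {g : ℕ → L2S1} {x : L2S1}
    (h : ∀ n, dist x (g n) < (1 / 2 : ℝ) ^ n) :
    ∀ᵐ θ, Tendsto (fun n => g n θ) atTop (𝓝 (x θ)) := by
  have hlim : Tendsto g atTop (𝓝 x) := by
    rw [tendsto_iff_dist_tendsto_zero]
    refine squeeze_zero (fun _ => dist_nonneg) (fun n => ?_)
      (tendsto_pow_atTop_nhds_zero_of_lt_one (by norm_num) (by norm_num : (1 / 2 : ℝ) < 1))
    rw [dist_comm]; exact (h n).le
  have hcau : ∀ᵐ θ, ∃ l : ℝ, Tendsto (fun n => g n θ) atTop (𝓝 l) := by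
    refine Lp.ae_tendsto_of_cauchy_eLpNorm (p := 2)
      (fun n => (Lp.stronglyMeasurable (g n)).aestronglyMeasurable)
      (by norm_num) (B := fun N => ENNReal.ofReal (2 * (1 / 2 : ℝ) ^ N)) ?_ ?_
    · rw [← ENNReal.ofReal_tsum_of_nonneg (fun n => by positivity)]
      · exact ENNReal.ofReal_ne_top
      · exact (summable_geometric_of_lt_one (by norm_num) (by norm_num)).mul_left 2
    · intro N n m hn hm
      have h1 : eLpNorm (⇑(g n) - ⇑(g m)) 2 volume = edist (g n) (g m) := by
        rw [Lp.edist_def]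
      rw [h1, edist_dist]
      refine (ENNReal.ofReal_lt_ofReal_iff (by positivity)).2 ?_
      have e1 : (1 / 2 : ℝ) ^ n ≤ (1 / 2) ^ N := pow_le_pow_of_le_one (by norm_num) (by norm_num) hn
      have e2 : (1 / 2 : ℝ) ^ m ≤ (1 / 2) ^ N := pow_le_pow_of_le_one (by norm_num) (by norm_num) hm
      have := dist_triangle_left (g n) (g m) x
      linarith [h n, h m]
  obtain ⟨ns, hns, hsub⟩ := (tendstoInMeasure_of_tendsto_Lp hlim).exists_seq_tendsto_ae
  filter_upwards [hcau, hsub] with θ ⟨l, hl⟩ hθ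
  have := tendsto_nhds_unique (hl.comp hns.tendsto_atTop) hθ
  rwa [← this]

/-- A continuous curve in the separable space `L²(S¹)` has a jointly measurable version: the values
of the curve are approximated by members of a dense sequence, chosen measurably, at a rate which
makes the approximations converge almost everywhere on each circle. -/
lemma exists_isVersion {R₀ : ℝ} {f : ℝ → L2S1} (hf : ContinuousOn f (Ici R₀)) :
    ∃ F : ℝ → S1 → ℝ, IsVersion R₀ f F := by
  classical
  have : Fact ((2 : ENNReal) ≠ ⊤) := ⟨by norm_num⟩
  -- extend the curve to a continuous one on the whole line
  set g : ℝ → L2S1 := fun R => f (max R₀ R) with hg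
  have hgc : Continuous g := by
    rw [← continuousOn_univ]
    exact hf.comp (by fun_prop) (fun R _ => mem_Ici.2 (le_max_left _ _))
  have hex : ∀ (n : ℕ) (R : ℝ), ∃ k : ℕ,
      dist (g R) (TopologicalSpace.denseSeq L2S1 k) < (1 / 2 : ℝ) ^ n := by
    intro n R
    obtain ⟨k, hk⟩ := (TopologicalSpace.denseRange_denseSeq L2S1).exists_dist_lt (g R)
      (show (0 : ℝ) < (1 / 2) ^ n by positivity)
    exact ⟨k, hk⟩
  let k : ℕ → ℝ → ℕ := fun n R => Nat.find (hex n R)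
  have hk : ∀ n, Measurable (k n) := fun n => measurable_find (hex n) fun j =>
    (isOpen_lt (hgc.dist continuous_const) continuous_const).measurableSet
  let G : ℕ → ℝ × S1 → ℝ := fun n p => TopologicalSpace.denseSeq L2S1 (k n p.1) p.2
  have hG : ∀ n, StronglyMeasurable (G n) := by
    intro n
    have h1 : Measurable (fun q : ℕ × S1 => TopologicalSpace.denseSeq L2S1 q.1 q.2) :=
      measurable_from_prod_countable_right fun j =>
        (Lp.stronglyMeasurable (TopologicalSpace.denseSeq L2S1 j)).measurable
    exact (h1.comp (((hk n).comp measurable_fst).prodMk measurable_snd)).stronglyMeasurable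
  refine ⟨fun R θ => limUnder atTop (fun n => G n (R, θ)),
    (show Measurable (fun p : ℝ × S1 => limUnder atTop (fun n => G n p)) from
      (StronglyMeasurable.limUnder hG).measurable), fun R hR => ?_⟩
  have hgR : g R = f R := by simp only [hg]; rw [max_eq_right hR]
  filter_upwards [ae_tendsto_of_dist_lt (g := fun n => TopologicalSpace.denseSeq L2S1 (k n R))
    (x := g R) (fun n => Nat.find_spec (hex n R))] with θ hθ
  rw [← hgR]
  exact hθ.limUnder_eq

/-- The slab `(R₁, R₂] × S¹` with its Lebesgue measure. -/
noncomputable abbrev slab (R₁ R₂ : ℝ) : Measure (ℝ × S1) :=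
  (volume.restrict (Ioc R₁ R₂)).prod volume

lemma Icc_subset_Ici_of_le {R₀ R₁ R₂ : ℝ} (h : R₀ ≤ R₁) : Icc R₁ R₂ ⊆ Ici R₀ :=
  fun _ hr => h.trans hr.1

lemma Ioc_subset_Ici_of_le {R₀ R₁ R₂ : ℝ} (h : R₀ ≤ R₁) : Ioc R₁ R₂ ⊆ Ici R₀ :=
  fun _ hr => h.trans hr.1.le

lemma IsVersion.memLp_slab {R₀ R₁ R₂ : ℝ} {f : ℝ → L2S1} {F : ℝ → S1 → ℝ}
    (hF : IsVersion R₀ f F) (hf : ContinuousOn f (Ici R₀)) (h1 : R₀ ≤ R₁) :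
    MemLp (Function.uncurry F) 2 (slab R₁ R₂) := by
  obtain ⟨C, hC⟩ := isCompact_Icc.exists_bound_of_continuousOn
    (hf.mono (Icc_subset_Ici_of_le h1 : Icc R₁ R₂ ⊆ Ici R₀))
  refine ⟨hF.measurable.aestronglyMeasurable, ?_⟩
  rw [eLpNorm_lt_top_iff_lintegral_rpow_enorm_lt_top (by norm_num) (by norm_num),
    lintegral_prod _ (hF.measurable.enorm.pow_const _).aemeasurable]
  refine (setLIntegral_mono' (g := fun _ => ENNReal.ofReal C ^ (2 : ℝ)) measurableSet_Ioc
    (fun R hR => ?_)).trans_lt ?_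
  · have hae := hF.ae_eq R (Ioc_subset_Ici_of_le h1 hR)
    have : ∫⁻ θ, ‖Function.uncurry F (R, θ)‖ₑ ^ (2 : ENNReal).toReal =
        eLpNorm (f R) 2 volume ^ (2 : ℝ) := by
      rw [eLpNorm_eq_lintegral_rpow_enorm_toReal (by norm_num) (by norm_num), ← ENNReal.rpow_mul]
      simp only [ENNReal.toReal_ofNat, one_div, ne_eq, OfNat.ofNat_ne_zero, not_false_eq_true,
        inv_mul_cancel₀, ENNReal.rpow_one]
      refine lintegral_congr_ae ?_
      filter_upwards [hae] with θ hθ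
      simp only [Function.uncurry, hθ]
    rw [this]
    refine ENNReal.rpow_le_rpow ?_ (by norm_num)
    rw [← Lp.enorm_def, ← ofReal_norm]
    exact ENNReal.ofReal_le_ofReal (hC R (Ioc_subset_Icc_self hR))
  · rw [lintegral_const]
    refine ENNReal.mul_lt_top (ENNReal.rpow_lt_top_of_nonneg (by norm_num) ENNReal.ofReal_ne_top) ?_
    simp

/-! ### Smooth functions on the circle and their translates -/

/-- Smooth functions on the circle, through their `2π`-periodic lifts. -/
def SmoothOnCircle (ψ : S1 → ℝ) : Prop := ContDiff ℝ ∞ (fun t : ℝ => ψ (t : S1))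

lemma dTheta_coe (ψ : S1 → ℝ) (t : ℝ) :
    dTheta ψ (t : S1) = deriv (fun s : ℝ => ψ (s : S1)) t := by
  unfold dTheta
  have : (fun s : ℝ => ψ ((t : S1) + (s : S1))) =
      fun s : ℝ => (fun r : ℝ => ψ (r : S1)) (t + s) := by
    funext s; simp
  rw [this, deriv_comp_const_add (fun r : ℝ => ψ (r : S1)) t 0, add_zero]

lemma SmoothOnCircle.dTheta {ψ : S1 → ℝ} (h : SmoothOnCircle ψ) :
    SmoothOnCircle (dTheta ψ) := by
  unfold SmoothOnCircle
  simp only [dTheta_coe]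
  exact ((contDiff_infty_iff_deriv (f := fun t : ℝ => ψ (t : S1))).1 h).2

lemma SmoothOnCircle.continuous {ψ : S1 → ℝ} (h : SmoothOnCircle ψ) : Continuous ψ :=
  (isQuotientMap_quotient_mk'.continuous_iff (g := ψ)).2
    (ContDiff.continuous (f := fun t : ℝ => ψ (t : S1)) h)

lemma SmoothOnCircle.hasDerivAt {ψ : S1 → ℝ} (h : SmoothOnCircle ψ) (θ : S1) (s : ℝ) :
    HasDerivAt (fun r : ℝ => ψ (θ + (r : S1))) (Gowdy.dTheta ψ (θ + (s : S1))) s := by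
  obtain ⟨t, rfl⟩ := QuotientAddGroup.mk_surjective θ
  change HasDerivAt (fun r : ℝ => ψ ((t : S1) + (r : S1))) (Gowdy.dTheta ψ ((t : S1) + (s : S1))) s
  simp only [← AddCircle.coe_add, dTheta_coe]
  have h1 : HasDerivAt (fun s : ℝ => ψ (s : S1)) (deriv (fun s : ℝ => ψ (s : S1)) (t + s)) (t + s) :=
    ((ContDiff.differentiable h (by simp)) _).hasDerivAt
  exact h1.comp_const_add t s

lemma SmoothOnCircle.translate {ψ : S1 → ℝ} (h : SmoothOnCircle ψ) (c : ℝ) :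
    SmoothOnCircle (fun θ => ψ (θ + (c : S1))) := by
  have h2 : ContDiff ℝ ∞ fun t : ℝ => (fun r : ℝ => ψ (r : S1)) (t + c) :=
    ContDiff.comp (g := fun r : ℝ => ψ (r : S1)) h (contDiff_id.add contDiff_const)
  unfold SmoothOnCircle
  simpa only [AddCircle.coe_add] using h2

lemma dTheta_translate {ψ : S1 → ℝ} (h : SmoothOnCircle ψ) (c : ℝ) (θ : S1) :
    dTheta (fun θ => ψ (θ + (c : S1))) θ = dTheta ψ (θ + (c : S1)) := by
  have h1 := (h.hasDerivAt (θ + (c : S1)) 0).deriv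
  simp only [AddCircle.coe_zero, add_zero] at h1
  rw [← h1]
  unfold dTheta
  congr 1; funext s
  rw [add_right_comm]

/-- The translate `θ ↦ ψ(θ + s)` as a continuous function on the circle. -/
noncomputable def shift (ψ : C(S1, ℝ)) (s : ℝ) : C(S1, ℝ) := ⟨fun θ => ψ (θ + (s : S1)), by fun_prop⟩

lemma continuous_shift (ψ : C(S1, ℝ)) : Continuous (shift ψ) :=
  (ContinuousMap.curry ⟨fun p : ℝ × S1 => ψ (p.2 + (p.1 : S1)),
    ψ.continuous.comp (continuous_snd.add
      ((AddCircle.continuous_mk' (2 * π)).comp continuous_fst))⟩).continuous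

/-- Translation is differentiable in the sup norm: the translates of `ψ'` form a continuous curve
in `C(S¹)` whose primitive is the curve of translates of `ψ`. -/
lemma hasDerivAt_shift {ψ ψ' : C(S1, ℝ)}
    (h : ∀ (θ : S1) (s : ℝ), HasDerivAt (fun r : ℝ => ψ (θ + (r : S1))) (ψ' (θ + (s : S1))) s)
    (s : ℝ) : HasDerivAt (shift ψ) (shift ψ' s) s := by
  have hc := continuous_shift ψ'
  have h1 : shift ψ = fun s => shift ψ 0 + ∫ r in (0 : ℝ)..s, shift ψ' r := by
    funext s
    ext θ
    have h2 := (ContinuousMap.evalCLM ℝ θ : C(S1, ℝ) →L[ℝ] ℝ).intervalIntegral_comp_comm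
      (hc.intervalIntegrable (μ := volume) 0 s)
    have h4 : (∫ r in (0 : ℝ)..s, shift ψ' r) θ = ∫ r in (0 : ℝ)..s, ψ' (θ + (r : S1)) := h2.symm
    have h5 : ∫ r in (0 : ℝ)..s, ψ' (θ + (r : S1)) =
        ψ (θ + (s : S1)) - ψ (θ + ((0 : ℝ) : S1)) :=
      intervalIntegral.integral_eq_sub_of_hasDerivAt (fun r _ => h θ r)
        (Continuous.intervalIntegrable (u := fun r : ℝ => ψ' (θ + (r : S1))) (by fun_prop) 0 s)
    rw [ContinuousMap.add_apply, h4, h5]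
    simp [shift]
  rw [h1]
  exact (intervalIntegral.integral_hasDerivAt_right (hc.intervalIntegrable 0 s)
    (hc.stronglyMeasurableAtFilter _ _) hc.continuousAt).const_add _

/-- A continuous function on the circle as an element of `L²(S¹)`. -/
noncomputable abbrev toL2 (ψ : C(S1, ℝ)) : L2S1 := ContinuousMap.toLp 2 volume ℝ ψ

lemma inner_toL2 (u : L2S1) (ψ : C(S1, ℝ)) : inner ℝ u (toL2 ψ) = ∫ θ, u θ * ψ θ := by
  rw [L2.inner_def]
  refine integral_congr_ae ?_
  filter_upwards [ContinuousMap.coeFn_toLp (p := 2) (𝕜 := ℝ) volume ψ] with θ hθ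
  rw [toL2, hθ]
  simp [mul_comm]

lemma hasDerivAt_toL2_shift {ψ : S1 → ℝ} (hψ : SmoothOnCircle ψ) (σ R : ℝ) :
    HasDerivAt (fun R => toL2 (shift ⟨ψ, hψ.continuous⟩ (σ * R)))
      (σ • toL2 (shift ⟨dTheta ψ, hψ.dTheta.continuous⟩ (σ * R))) R := by
  have h1 := hasDerivAt_shift (ψ := ⟨ψ, hψ.continuous⟩) (ψ' := ⟨dTheta ψ, hψ.dTheta.continuous⟩)
    hψ.hasDerivAt (σ * R)
  have h2 := h1.scomp R ((hasDerivAt_id R).const_mul σ)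
  have h3 := (ContinuousMap.toLp 2 volume ℝ : C(S1, ℝ) →L[ℝ] L2S1).hasFDerivAt.comp_hasDerivAt R h2
  simpa [Function.comp_def] using h3

/-- Fundamental lemma of the calculus of variations on the circle. It is reduced to the interval
`(0, 2π)`: the periodic extension of a function with compact support in `(0, 2π)` is smooth. -/
lemma ae_eq_zero_of_forall_integral_mul_smooth {f : S1 → ℝ} (hf : Integrable f volume)
    (h : ∀ ψ : S1 → ℝ, SmoothOnCircle ψ → ∫ θ, f θ * ψ θ = 0) : f =ᵐ[volume] 0 := by
  have hpi := Real.two_pi_pos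
  have hmp := AddCircle.measurePreserving_mk (2 * π) 0
  rw [zero_add] at hmp
  have hint : IntegrableOn (fun t : ℝ => f (t : S1)) (Ioc 0 (2 * π)) :=
    hmp.integrable_comp_of_integrable hf
  have key : ∀ᵐ t : ℝ, t ∈ Ioo 0 (2 * π) → f (t : S1) = 0 := by
    refine isOpen_Ioo.ae_eq_zero_of_integral_contDiff_smul_eq_zero
      (hint.mono_set Ioo_subset_Ioc_self).locallyIntegrableOn fun g hg _ hsupp => ?_
    set ψ : S1 → ℝ := AddCircle.liftIco (2 * π) 0 g with hψ
    have hψg : ∀ t ∈ Ico (0 : ℝ) (2 * π), ψ (t : S1) = g t := fun t ht =>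
      AddCircle.liftIco_coe_apply (by simpa using ht)
    have hg0 : ∀ t, t ∉ Ioo (0 : ℝ) (2 * π) → g t = 0 := fun t ht =>
      image_eq_zero_of_notMem_tsupport fun h' => ht (hsupp h')
    have hsmooth : SmoothOnCircle ψ := by
      have hbase : ∀ t ∈ Ico (0 : ℝ) (2 * π), ContDiffAt ℝ ∞ (fun t : ℝ => ψ (t : S1)) t := by
        intro t ht
        rcases ht.1.eq_or_lt with rfl | hpos
        · -- near `0` the lift vanishes, since the support of `g` avoids both `0` and `2π`
          have e1 : ∀ᶠ s in 𝓝 (0 : ℝ), s ∉ tsupport g :=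
            (isClosed_tsupport g).isOpen_compl.mem_nhds fun h' => (hsupp h').1.ne rfl
          have e2 : ∀ᶠ s in 𝓝 (0 : ℝ), s + 2 * π ∉ tsupport g :=
            (isClosed_tsupport g).isOpen_compl.preimage (continuous_add_const (2 * π))
              |>.mem_nhds fun h' => by
                have := (hsupp h').2
                simp at this
          have e3 : ∀ᶠ s in 𝓝 (0 : ℝ), s ∈ Ioo (-(2 * π)) (2 * π) :=
            Ioo_mem_nhds (by linarith) hpi
          refine (contDiffAt_const (c := (0 : ℝ))).congr_of_eventuallyEq ?_
          filter_upwards [e1, e2, e3] with s h1 h2 h3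
          rcases le_or_gt 0 s with hs | hs
          · rw [hψg s ⟨hs, h3.2⟩, image_eq_zero_of_notMem_tsupport h1]
          · have : (s : S1) = ((s + 2 * π : ℝ) : S1) := by simp
            rw [this, hψg _ ⟨by linarith [h3.1], by linarith⟩,
              image_eq_zero_of_notMem_tsupport h2]
        · refine hg.contDiffAt.congr_of_eventuallyEq ?_
          filter_upwards [Ioo_mem_nhds hpos ht.2] with s hs
          exact hψg s (Ioo_subset_Ico_self hs)
      refine contDiff_iff_contDiffAt.2 fun t => ?_
      have hper : (fun s : ℝ => ψ (s : S1)) =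
          fun s : ℝ => (fun r : ℝ => ψ (r : S1)) (s - toIcoDiv hpi 0 t • (2 * π)) := by
        funext s
        simp only [AddCircle.coe_sub]
        congr 1
        rw [eq_comm, sub_eq_self, AddCircle.coe_zsmul, AddCircle.coe_period, smul_zero]
      rw [hper]
      have hmem := sub_toIcoDiv_zsmul_mem_Ico hpi 0 t
      rw [zero_add] at hmem
      exact ContDiffAt.comp (g := fun r : ℝ => ψ (r : S1)) t (hbase _ hmem)
        (contDiffAt_id.sub contDiffAt_const)
    have h1 := h ψ hsmooth
    rw [← AddCircle.integral_preimage (2 * π) 0, zero_add, integral_Ioc_eq_integral_Ioo] at h1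
    rw [← h1, ← setIntegral_eq_integral_of_forall_compl_eq_zero (s := Ioo 0 (2 * π))]
    · refine setIntegral_congr_fun measurableSet_Ioo fun t ht => ?_
      simp only [smul_eq_mul]
      rw [hψg t (Ioo_subset_Ico_self ht), mul_comm]
    · intro t ht; rw [hg0 t ht, zero_smul]
  have h0 : ∫⁻ θ : S1, ‖f θ‖ₑ = 0 := by
    rw [← AddCircle.lintegral_preimage (2 * π) 0, zero_add, setLIntegral_congr Ioo_ae_eq_Ioc.symm]
    rw [lintegral_eq_zero_of_ae_eq_zero]
    refine (ae_restrict_iff' measurableSet_Ioo).2 ?_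
    filter_upwards [key] with t ht htm
    simp [ht htm]
  have := (lintegral_eq_zero_iff' hf.1.enorm).1 h0
  filter_upwards [this] with θ hθ
  simpa using hθ

/-! ### Integration along characteristics and the Sobolev inequality -/

/-- The shear `(R, c) ↦ (R, c - σR)`, which straightens the lines `θ + σR = const`, preserves the
measure of slabs. -/
lemma measurePreserving_shear (σ R₁ R₂ : ℝ) :
    MeasurePreserving (fun q : ℝ × S1 => (q.1, q.2 - ((σ * q.1 : ℝ) : S1)))
      (slab R₁ R₂) (slab R₁ R₂) := by
  refine (MeasurePreserving.id _).skew_product (g := fun R c => c - ((σ * R : ℝ) : S1)) ?_ ?_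
  · exact measurable_snd.sub (AddCircle.measurable_mk'.comp (measurable_fst.const_mul σ))
  · exact Eventually.of_forall fun R => (measurePreserving_sub_right volume _).map_eq

/-- If, tested against all functions transported along the lines `θ + σR = const`, the function `p`
has derivative `f`, then along almost every such line `p` is a primitive of `f`. -/
lemma ae_sub_eq_integral_of_transport {σ R₁ R₂ : ℝ} {p f : ℝ → S1 → ℝ} (h12 : R₁ ≤ R₂)
    (hp₁ : Integrable (p R₁) volume) (hp₂ : Integrable (p R₂) volume)
    (hf : Integrable (Function.uncurry f) (slab R₁ R₂))
    (h : ∀ ψ : S1 → ℝ, SmoothOnCircle ψ →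
      (∫ θ, p R₂ θ * ψ (θ + ((σ * R₂ : ℝ) : S1))) - ∫ θ, p R₁ θ * ψ (θ + ((σ * R₁ : ℝ) : S1)) =
        ∫ R in R₁..R₂, ∫ θ, f R θ * ψ (θ + ((σ * R : ℝ) : S1))) :
    ∀ᵐ c : S1, p R₂ (c - ((σ * R₂ : ℝ) : S1)) - p R₁ (c - ((σ * R₁ : ℝ) : S1)) =
      ∫ R in R₁..R₂, f R (c - ((σ * R : ℝ) : S1)) := by
  have hf' : Integrable (fun q : ℝ × S1 => f q.1 (q.2 - ((σ * q.1 : ℝ) : S1))) (slab R₁ R₂) :=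
    (measurePreserving_shear σ R₁ R₂).integrable_comp_of_integrable hf
  have htr : ∀ (g ψ : S1 → ℝ) (a : S1), ∫ θ, g θ * ψ (θ + a) = ∫ c, g (c - a) * ψ c := by
    intro g ψ a
    rw [← integral_sub_right_eq_self (fun θ => g θ * ψ (θ + a)) a]
    simp
  have hi₁ : Integrable (fun c => p R₁ (c - ((σ * R₁ : ℝ) : S1))) volume := hp₁.comp_sub_right _
  have hi₂ : Integrable (fun c => p R₂ (c - ((σ * R₂ : ℝ) : S1))) volume := hp₂.comp_sub_right _
  have hi₃ : Integrable (fun c => ∫ R in R₁..R₂, f R (c - ((σ * R : ℝ) : S1))) volume := by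
    simp only [intervalIntegral.integral_of_le h12]
    exact hf'.integral_prod_right
  have hz := ae_eq_zero_of_forall_integral_mul_smooth ((hi₂.sub hi₁).sub hi₃) fun ψ hψ => by
    obtain ⟨C, hC⟩ := isCompact_univ.exists_bound_of_continuousOn hψ.continuous.continuousOn
    have hb : ∀ {g : S1 → ℝ}, Integrable g volume → Integrable (fun c => g c * ψ c) volume :=
      fun hg => hg.mul_bdd (c := C) hψ.continuous.aestronglyMeasurable
        (Eventually.of_forall fun c => hC c (mem_univ c))
    have h1 := h ψ hψ
    simp only [htr] at h1
    -- in the sheared coordinates the test function does not depend on `R`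
    have h2 : ∫ R in R₁..R₂, ∫ c, f R (c - ((σ * R : ℝ) : S1)) * ψ c =
        ∫ c, (∫ R in R₁..R₂, f R (c - ((σ * R : ℝ) : S1))) * ψ c := by
      simp only [intervalIntegral.integral_of_le h12]
      rw [integral_integral_swap]
      · simp only [integral_mul_const]
      · exact hf'.mul_bdd (c := C) (hψ.continuous.comp continuous_snd).aestronglyMeasurable
          (Eventually.of_forall fun c => hC c.2 (mem_univ _))
    simp only [Pi.sub_apply, sub_mul]
    calc ∫ c, (p R₂ (c - ((σ * R₂ : ℝ) : S1)) * ψ c - p R₁ (c - ((σ * R₁ : ℝ) : S1)) * ψ c -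
          (∫ R in R₁..R₂, f R (c - ((σ * R : ℝ) : S1))) * ψ c)
        = (∫ c, (p R₂ (c - ((σ * R₂ : ℝ) : S1)) * ψ c - p R₁ (c - ((σ * R₁ : ℝ) : S1)) * ψ c)) -
          ∫ c, (∫ R in R₁..R₂, f R (c - ((σ * R : ℝ) : S1))) * ψ c :=
          integral_sub ((hb hi₂).sub (hb hi₁)) (hb hi₃)
      _ = 0 := by rw [integral_sub (hb hi₂) (hb hi₁), h1, h2, sub_self]
  filter_upwards [hz] with c hc
  exact sub_eq_zero.1 hc

lemma HasWeakDeriv.integral_translate {u w : L2S1} (h : HasWeakDeriv u w) {ψ : S1 → ℝ}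
    (hψ : SmoothOnCircle ψ) (c : ℝ) :
    ∫ θ, u θ * dTheta ψ (θ + (c : S1)) = - ∫ θ, w θ * ψ (θ + (c : S1)) := by
  have := h (fun θ => ψ (θ + (c : S1))) (hψ.translate c)
  simpa only [dTheta_translate hψ] using this

lemma HasWeakDeriv.inner_shift {u w : L2S1} (h : HasWeakDeriv u w) {ψ : S1 → ℝ}
    (hψ : SmoothOnCircle ψ) (c : ℝ) :
    inner ℝ u (toL2 (shift ⟨dTheta ψ, hψ.dTheta.continuous⟩ c)) =
      - inner ℝ w (toL2 (shift ⟨ψ, hψ.continuous⟩ c)) := by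
  rw [inner_toL2, inner_toL2]
  exact h.integral_translate hψ c

lemma continuous_toL2_shift (ψ : C(S1, ℝ)) (σ : ℝ) :
    Continuous (fun R : ℝ => toL2 (shift ψ (σ * R))) :=
  (ContinuousMap.toLp 2 volume ℝ : C(S1, ℝ) →L[ℝ] L2S1).continuous.comp
    ((continuous_shift ψ).comp (continuous_const.mul continuous_id))

lemma integrable_sq_coe (u : L2S1) : Integrable (fun θ => u θ ^ 2) volume :=
  (Lp.memLp u).integrable_sq

lemma integral_sq_coe (u : L2S1) : ∫ θ, u θ ^ 2 = ‖u‖ ^ 2 := by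
  rw [← real_inner_self_eq_norm_sq, L2.inner_def]
  simp [sq]

lemma integrable_coe (u : L2S1) : Integrable (fun θ => u θ) volume :=
  (Lp.memLp u).integrable (by norm_num)

lemma volume_univ_S1 : (volume : Measure S1).real univ = 2 * π := by
  rw [Measure.real, AddCircle.measure_univ, ENNReal.toReal_ofReal Real.two_pi_pos.le]

lemma integral_abs_coe_le (u : L2S1) : ∫ θ, |u θ| ≤ π + ‖u‖ ^ 2 / 2 := by
  have h1 : ∫ θ, |u θ| ≤ ∫ θ, (1 / 2 + u θ ^ 2 / 2) := by
    refine integral_mono (integrable_coe u).abs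
      ((integrable_const _).add ((integrable_sq_coe u).div_const 2)) fun θ => ?_
    have := sq_nonneg (|u θ| - 1)
    rw [sub_sq, sq_abs] at this
    simp only; linarith
  rw [integral_add (integrable_const _) ((integrable_sq_coe u).div_const 2), integral_const,
    integral_div, integral_sq_coe, volume_univ_S1] at h1
  simp only [smul_eq_mul] at h1
  linarith

/-- The one-dimensional Sobolev inequality `H¹(S¹) ⊆ L^∞(S¹)`: the increments of `u` are integrals
of `w`, and averaging over the base point bounds `u` itself. -/
lemma HasWeakDeriv.ae_abs_le {u w : L2S1} (h : HasWeakDeriv u w) :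
    ∀ᵐ θ, |u θ| ≤ 2 * π + ‖u‖ ^ 2 + ‖w‖ ^ 2 := by
  have hpi := Real.two_pi_pos
  set W : ℝ := ∫ θ, |w θ| with hW
  have hum : Measurable u := (Lp.stronglyMeasurable u).measurable
  -- the increments are primitives of `w`: transport with `p(s, θ) = u(θ)` and speed `-1`
  have hinc : ∀ s : ℝ, 0 ≤ s → ∀ᵐ c : S1, u (c - ((-1 * s : ℝ) : S1)) -
      u (c - ((-1 * 0 : ℝ) : S1)) = ∫ r in (0 : ℝ)..s, w (c - ((-1 * r : ℝ) : S1)) := by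
    intro s hs
    refine ae_sub_eq_integral_of_transport (p := fun _ => u) (f := fun _ => w) hs
      (integrable_coe u) (integrable_coe u) ?_ fun ψ hψ => ?_
    · exact (integrable_coe w).comp_snd _
    · have hd : ∀ r : ℝ, HasDerivAt
          (fun r => (inner ℝ u (toL2 (shift ⟨ψ, hψ.continuous⟩ (-1 * r))) : ℝ))
          (inner ℝ w (toL2 (shift ⟨ψ, hψ.continuous⟩ (-1 * r)))) r := by
        intro r
        have h1 := (hasDerivAt_const r u).inner ℝ (hasDerivAt_toL2_shift hψ (-1) r)
        rw [inner_zero_left, add_zero, inner_smul_right, h.inner_shift hψ] at h1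
        simpa using h1
      have hc := (continuous_const (y := w)).inner (𝕜 := ℝ)
        (continuous_toL2_shift ⟨ψ, hψ.continuous⟩ (-1))
      have := intervalIntegral.integral_eq_sub_of_hasDerivAt (fun r _ => hd r)
        (hc.intervalIntegrable 0 s)
      simp only [inner_toL2] at this
      exact this.symm
  have hbound : ∀ θ : S1, ∀ᵐ c : S1, |u (c + θ) - u c| ≤ W := by
    intro θ
    obtain ⟨s, hs, rfl⟩ : ∃ s ∈ Ioc (0 : ℝ) (0 + 2 * π), (s : S1) = θ := by
      have := AddCircle.coe_image_Ioc_eq (2 * π) 0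
      have hθ : θ ∈ ((↑) : ℝ → S1) '' Ioc (0 : ℝ) (0 + 2 * π) := by rw [this]; trivial
      exact hθ
    filter_upwards [hinc s hs.1.le] with c hc
    simp only [neg_mul, one_mul, AddCircle.coe_neg, sub_neg_eq_add, AddCircle.coe_zero,
      sub_zero, mul_zero] at hc
    rw [hc]
    have hmp := AddCircle.measurePreserving_mk (2 * π) 0
    have hwi : IntegrableOn (fun r : ℝ => |w (c + (r : S1))|) (Ioc 0 (0 + 2 * π)) :=
      hmp.integrable_comp_of_integrable (((integrable_coe w).comp_add_left c).abs)
    calc |∫ r in (0 : ℝ)..s, w (c + (r : S1))|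
        ≤ ∫ r in (0 : ℝ)..s, |w (c + (r : S1))| :=
          intervalIntegral.abs_integral_le_integral_abs hs.1.le
      _ ≤ ∫ r in Ioc (0 : ℝ) (0 + 2 * π), |w (c + (r : S1))| := by
          rw [intervalIntegral.integral_of_le hs.1.le]
          exact setIntegral_mono_set hwi (Eventually.of_forall fun _ => abs_nonneg _)
            (Ioc_subset_Ioc_right hs.2).eventuallyLE
      _ = ∫ θ, |w (c + θ)| := AddCircle.integral_preimage (2 * π) 0 (fun θ => |w (c + θ)|)
      _ = W := integral_add_left_eq_self (fun θ => |w θ|) c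
  have hae : ∀ᵐ c : S1, ∀ᵐ θ : S1, |u (c + θ) - u c| ≤ W := by
    rw [Measure.ae_ae_comm (p := fun c θ => |u (c + θ) - u c| ≤ W)]
    · exact Eventually.of_forall hbound
    · refine measurableSet_le (Measurable.abs ?_) measurable_const
      exact (hum.comp (measurable_fst.add measurable_snd)).sub (hum.comp measurable_fst)
  filter_upwards [hae] with c hc
  have h1 : ∫ _ : S1, |u c| ≤ ∫ θ : S1, (|u (c + θ)| + W) := by
    refine integral_mono_ae (integrable_const _)
      ((((integrable_coe u).comp_add_left c).abs).add (integrable_const _)) ?_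
    filter_upwards [hc] with θ hθ
    have := abs_sub_abs_le_abs_sub (u c) (u (c + θ))
    rw [abs_sub_comm] at hθ
    linarith
  rw [integral_add ((integrable_coe u).comp_add_left c).abs (integrable_const _),
    integral_add_left_eq_self (fun θ => |u θ|) c, integral_const, integral_const,
    volume_univ_S1] at h1
  simp only [smul_eq_mul] at h1
  have h2 := integral_abs_coe_le u
  have h3 := integral_abs_coe_le w
  have hpi3 := Real.pi_gt_three
  have h4 : 2 * π * (|u c| - W) ≤ π + ‖u‖ ^ 2 / 2 := by linarith
  have h5 : |u c| - W ≤ 1 / 2 + ‖u‖ ^ 2 / 2 := by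
    by_contra hlt
    push Not at hlt
    nlinarith [sq_nonneg ‖u‖]
  nlinarith [sq_nonneg ‖u‖, sq_nonneg ‖w‖]

lemma Field.exists_ae_abs_le {R₀ : ℝ} (V : Field R₀) (R₂ : ℝ) :
    ∃ C : ℝ, ∀ R ∈ Icc R₀ R₂, ∀ᵐ θ, |V.val R θ| ≤ C := by
  obtain ⟨C₁, h₁⟩ := isCompact_Icc.exists_bound_of_continuousOn
    (V.continuousOn_val.mono (Icc_subset_Ici_self : Icc R₀ R₂ ⊆ Ici R₀))
  obtain ⟨C₂, h₂⟩ := isCompact_Icc.exists_bound_of_continuousOn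
    (V.continuousOn_dθ.mono (Icc_subset_Ici_self : Icc R₀ R₂ ⊆ Ici R₀))
  refine ⟨2 * π + C₁ ^ 2 + C₂ ^ 2, fun R hR => ?_⟩
  filter_upwards [(V.hasWeakDeriv R hR.1).ae_abs_le] with θ hθ
  have e1 := pow_le_pow_left₀ (norm_nonneg _) (h₁ R hR) 2
  have e2 := pow_le_pow_left₀ (norm_nonneg _) (h₂ R hR) 2
  linarith

/-! ### Distributional derivatives in one variable -/

/-- Smooth functions of `R` whose support is a compact subset of `(R₀, ∞)`. -/
structure IsRadialTest (R₀ : ℝ) (χ : ℝ → ℝ) : Prop where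
  smooth : ContDiff ℝ ∞ χ
  support : ∃ a b : ℝ, R₀ < a ∧ ∀ R, R ∉ Icc a b → χ R = 0

variable {χ : ℝ → ℝ}

lemma IsRadialTest.deriv (h : IsRadialTest R₀ χ) : IsRadialTest R₀ (deriv χ) := by
  obtain ⟨a, b, ha, hab⟩ := h.support
  refine ⟨((contDiff_infty_iff_deriv (f := χ)).1 h.smooth).2, a, b, ha, fun R hR => ?_⟩
  have : χ =ᶠ[𝓝 R] fun _ => 0 := by
    filter_upwards [isClosed_Icc.isOpen_compl.mem_nhds hR] with s hs using hab s hs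
  rw [this.deriv_eq, deriv_const]

lemma IsRadialTest.hasDerivAt (h : IsRadialTest R₀ χ) (R : ℝ) :
    HasDerivAt χ (_root_.deriv χ R) R :=
  (h.smooth.differentiable (by simp) R).hasDerivAt

lemma isRadialTest_of_tsupport_subset (hχ : ContDiff ℝ ∞ χ) (hc : HasCompactSupport χ)
    (hs : tsupport χ ⊆ Ioi R₀) : IsRadialTest R₀ χ := by
  refine ⟨hχ, ?_⟩
  rcases (tsupport χ).eq_empty_or_nonempty with he | hne
  · refine ⟨R₀ + 1, R₀ + 1, by linarith, fun R _ => image_eq_zero_of_notMem_tsupport ?_⟩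
    simp [he]
  · obtain ⟨a, ha⟩ := IsCompact.exists_isLeast hc hne
    obtain ⟨b, hb⟩ := IsCompact.exists_isGreatest hc hne
    exact ⟨a, b, hs ha.1, fun R hR => image_eq_zero_of_notMem_tsupport fun h =>
      hR ⟨ha.2 h, hb.2 h⟩⟩

/-- Integrals against a test function are integrals over a bounded interval. -/
lemma setIntegral_Ioi_eq_of_eq_zero {g : ℝ → ℝ} {a b B : ℝ} (ha : R₀ < a) (hB : R₀ ≤ B)
    (hbB : b ≤ B) (hg : ∀ R, R ∉ Icc a b → g R = 0) :
    ∫ R in Ioi R₀, g R = ∫ R in R₀..B, g R := by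
  rw [intervalIntegral.integral_of_le hB]
  refine setIntegral_eq_of_subset_of_forall_sdiff_eq_zero measurableSet_Ioi Ioc_subset_Ioi_self
    fun R hR => hg R fun h => hR.2 ⟨ha.trans_le h.1, h.2.trans hbB⟩

lemma IsRadialTest.integrableOn_mul (h : IsRadialTest R₀ χ) {g : ℝ → ℝ}
    (hg : ∀ b, IntegrableOn g (Ioc R₀ b)) : IntegrableOn (fun R => χ R * g R) (Ioi R₀) := by
  obtain ⟨a, b, ha, hab⟩ := h.support
  have h1 : IntegrableOn (fun R => χ R * g R) (Ioc R₀ b) := by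
    obtain ⟨C, hC⟩ := isCompact_Icc.exists_bound_of_continuousOn
      (h.smooth.continuous.continuousOn (s := Icc R₀ b))
    refine (hg b).bdd_mul (c := C) h.smooth.continuous.aestronglyMeasurable ?_
    filter_upwards [ae_restrict_mem measurableSet_Ioc] with R hR
      using hC R (Ioc_subset_Icc_self hR)
  refine h1.of_forall_sdiff_eq_zero measurableSet_Ioi fun R hR => ?_
  rw [hab R fun h' => hR.2 ⟨hR.1, h'.2⟩, zero_mul]

lemma integrableOn_Ioc_of_continuousOn_Ici {g : ℝ → ℝ} (hg : ContinuousOn g (Ici R₀)) (b : ℝ) :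
    IntegrableOn g (Ioc R₀ b) :=
  ((hg.mono Icc_subset_Ici_self).integrableOn_Icc (b := b)).mono_set Ioc_subset_Icc_self

/-- A continuous function on `[R₀, ∞)` whose distributional derivative vanishes is constant. -/
lemma exists_eqOn_const_of_forall_test {k : ℝ → ℝ} (hk : ContinuousOn k (Ici R₀))
    (h : ∀ χ, IsRadialTest R₀ χ → ∫ R in Ioi R₀, deriv χ R * k R = 0) :
    ∃ K, ∀ R ∈ Ici R₀, k R = K := by
  -- it suffices to compare with one fixed test function `η` of integral one
  obtain ⟨η, hηs, hη1⟩ : ∃ η : ℝ → ℝ, IsRadialTest R₀ η ∧ ∫ R in Ioi R₀, η R = 1 := by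
    let f : ContDiffBump (R₀ + 3 : ℝ) := ⟨1, 2, by norm_num, by norm_num⟩
    have hsupp : tsupport (f.normed volume) ⊆ Ioi R₀ := by
      rw [f.tsupport_normed_eq, Real.closedBall_eq_Icc]
      intro x hx
      have := hx.1
      simp only [mem_Ioi]
      simp only [f] at this
      linarith
    refine ⟨f.normed volume, isRadialTest_of_tsupport_subset f.contDiff_normed
      f.hasCompactSupport_normed hsupp, ?_⟩
    rw [setIntegral_eq_integral_of_forall_compl_eq_zero, f.integral_normed]
    exact fun x hx => image_eq_zero_of_notMem_tsupport fun h' => hx (hsupp h')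
  have hki : ∀ b, IntegrableOn k (Ioc R₀ b) := integrableOn_Ioc_of_continuousOn_Ici hk
  set K := ∫ R in Ioi R₀, η R * k R with hK
  have hone : ∀ b, IntegrableOn (fun _ : ℝ => (1 : ℝ)) (Ioc R₀ b) := fun b => by simp
  have hae : ∀ᵐ R : ℝ, R ∈ Ioi R₀ → (fun R => k R - K) R = 0 := by
    refine isOpen_Ioi.ae_eq_zero_of_integral_contDiff_smul_eq_zero
      (((hk.mono Ioi_subset_Ici_self).sub continuousOn_const).locallyIntegrableOn
        measurableSet_Ioi) fun g hg hgc hgs => ?_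
    have hgt := isRadialTest_of_tsupport_subset hg hgc hgs
    obtain ⟨a₁, b₁, ha₁, h₁⟩ := hgt.support
    obtain ⟨a₂, b₂, ha₂, h₂⟩ := hηs.support
    set m := ∫ R in Ioi R₀, g R with hm
    have hcont : Continuous fun R => g R - m * η R :=
      hgt.smooth.continuous.sub (continuous_const.mul hηs.smooth.continuous)
    -- `g - m η` has integral zero, so its primitive is again a test function
    let Φ : ℝ → ℝ := fun R => ∫ r in R₀..R, (g r - m * η r)
    have hΦd : ∀ R, HasDerivAt Φ (g R - m * η R) R := fun R =>
      intervalIntegral.integral_hasDerivAt_right (hcont.intervalIntegrable _ _)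
        (hcont.stronglyMeasurableAtFilter _ _) hcont.continuousAt
    have hΦ' : deriv Φ = fun R => g R - m * η R := funext fun R => (hΦd R).deriv
    have hz : ∀ R, R ∉ Icc (min a₁ a₂) (max b₁ b₂) → g R - m * η R = 0 := fun R hR => by
      rw [h₁ R fun h' => hR ⟨(min_le_left _ _).trans h'.1, h'.2.trans (le_max_left _ _)⟩,
        h₂ R fun h' => hR ⟨(min_le_right _ _).trans h'.1, h'.2.trans (le_max_right _ _)⟩]
      simp
    have hΦt : IsRadialTest R₀ Φ := by
      refine ⟨contDiff_infty_iff_deriv.2 ⟨fun R => (hΦd R).differentiableAt, ?_⟩,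
        min a₁ a₂, max (max b₁ b₂) R₀, lt_min ha₁ ha₂, fun R hR => ?_⟩
      · rw [hΦ']; exact hgt.smooth.sub (contDiff_const.mul hηs.smooth)
      · rcases lt_or_ge R (min a₁ a₂) with hlt | hge
        · refine (intervalIntegral.integral_congr (g := fun _ => (0 : ℝ)) fun r hr => ?_).trans
            (by simp)
          refine hz r fun h' => ?_
          have : r ≤ max R₀ R := hr.2
          exact absurd h'.1 (not_le.2 (this.trans_lt (max_lt (lt_min ha₁ ha₂) hlt)))
        · have hRb : max (max b₁ b₂) R₀ < R := not_le.1 fun hle => hR ⟨hge, hle⟩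
          change ∫ r in R₀..R, (g r - m * η r) = 0
          rw [← setIntegral_Ioi_eq_of_eq_zero (lt_min ha₁ ha₂) ((le_max_right _ _).trans hRb.le)
            ((le_max_left _ _).trans hRb.le) hz]
          have i1 : IntegrableOn g (Ioi R₀) := by simpa using hgt.integrableOn_mul hone
          have i2 : IntegrableOn η (Ioi R₀) := by simpa using hηs.integrableOn_mul hone
          rw [integral_sub i1 (i2.const_mul m), integral_const_mul, hη1]
          simp [hm]
    have h0 := h Φ hΦt
    rw [hΦ'] at h0
    simp only [sub_mul, mul_assoc] at h0
    rw [integral_sub (hgt.integrableOn_mul hki) ((hηs.integrableOn_mul hki).const_mul m),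
      integral_const_mul, ← hK] at h0
    rw [← setIntegral_eq_integral_of_forall_compl_eq_zero (s := Ioi R₀)]
    · simp only [smul_eq_mul, mul_sub]
      rw [integral_sub (hgt.integrableOn_mul hki), integral_mul_const]
      · exact h0
      · have i1 : IntegrableOn g (Ioi R₀) := by simpa using hgt.integrableOn_mul hone
        exact i1.mul_const K
    · intro R hR
      rw [image_eq_zero_of_notMem_tsupport fun h' => hR (hgs h'), zero_smul]
  refine ⟨K, fun R hR => ?_⟩
  have hres : k =ᵐ[volume.restrict (Ici R₀)] fun _ => K := by
    rw [← restrict_Ioi_eq_restrict_Ici]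
    refine (ae_restrict_iff' measurableSet_Ioi).2 ?_
    filter_upwards [hae] with R h1 h2 using sub_eq_zero.1 (h1 h2)
  refine Measure.eqOn_of_ae_eq hres hk continuousOn_const ?_ hR
  rw [interior_Ici, closure_Ioi]

/-- A continuous function with distributional derivative `δ ∈ L¹_loc` is a primitive of `δ`. -/
lemma sub_eq_integral_of_forall_test {α δ : ℝ → ℝ} (hα : ContinuousOn α (Ici R₀))
    (hδ : ∀ b, IntegrableOn δ (Ioc R₀ b))
    (h : ∀ χ, IsRadialTest R₀ χ →
      ∫ R in Ioi R₀, deriv χ R * α R = - ∫ R in Ioi R₀, χ R * δ R)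
    {R₁ R₂ : ℝ} (h1 : R₀ ≤ R₁) (h2 : R₁ ≤ R₂) : α R₂ - α R₁ = ∫ R in R₁..R₂, δ R := by
  have hint : ∀ {b}, R₀ ≤ b → IntervalIntegrable δ volume R₀ b := fun hb =>
    (intervalIntegrable_iff_integrableOn_Ioc_of_le hb).2 (hδ _)
  have hAC : ∀ {b}, R₀ ≤ b →
      AbsolutelyContinuousOnInterval (fun R => ∫ r in R₀..R, δ r) R₀ b := fun hb =>
    (hint hb).absolutelyContinuousOnInterval_intervalIntegral left_mem_uIcc
  have hHc : ContinuousOn (fun R => ∫ r in R₀..R, δ r) (Ici R₀) := by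
    intro R hR
    have hR' : R₀ ≤ R + 1 := by have := mem_Ici.1 hR; linarith
    have := (hAC hR').continuousOn R (by rw [uIcc_of_le hR']; exact ⟨hR, by linarith⟩)
    rw [uIcc_of_le hR'] at this
    refine this.mono_of_mem_nhdsWithin ?_
    rw [← Ici_inter_Iic]
    exact inter_mem_nhdsWithin _ (Iic_mem_nhds (by linarith))
  -- `α` minus the primitive of `δ` has vanishing distributional derivative
  obtain ⟨K, hK⟩ := exists_eqOn_const_of_forall_test (hα.sub hHc) fun χ hχ => by
    have i1 := hχ.deriv.integrableOn_mul (integrableOn_Ioc_of_continuousOn_Ici hα)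
    have i2 := hχ.deriv.integrableOn_mul (integrableOn_Ioc_of_continuousOn_Ici hHc)
    simp only [Pi.sub_apply, mul_sub]
    rw [integral_sub i1 i2, h χ hχ]
    obtain ⟨a, b, ha, hab⟩ := hχ.support
    obtain ⟨a', b', ha', hab'⟩ := hχ.deriv.support
    set B := max R₀ (max b b') + 1 with hB
    have hB0 : R₀ ≤ B := by linarith [le_max_left R₀ (max b b')]
    have hBb : b < B := by linarith [le_max_right R₀ (max b b'), le_max_left b b']
    have hBb' : b' ≤ B := by linarith [le_max_right R₀ (max b b'), le_max_right b b']
    rw [setIntegral_Ioi_eq_of_eq_zero ha hB0 hBb.le (fun R hR => by rw [hab R hR, zero_mul]),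
      setIntegral_Ioi_eq_of_eq_zero ha' hB0 hBb' (fun R hR => by rw [hab' R hR, zero_mul])]
    have hχAC : AbsolutelyContinuousOnInterval χ R₀ B :=
      (hχ.smooth.of_le (by norm_cast)).contDiffOn.absolutelyContinuousOnInterval
    have hibp := (hAC hB0).integral_mul_deriv_eq_deriv_mul hχAC
    rw [hab B (fun h' => absurd h'.2 (not_le.2 hBb)),
      hab R₀ (fun h' => absurd h'.1 (not_le.2 ha))] at hibp
    have e1 : ∫ R in R₀..B, _root_.deriv (fun R => ∫ r in R₀..R, δ r) R * χ R =
        ∫ R in R₀..B, χ R * δ R := by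
      refine intervalIntegral.integral_congr_ae ?_
      filter_upwards [(hint hB0).ae_hasDerivAt_integral] with R hR hm
      rw [(hR (uIoc_subset_uIcc hm) R₀ left_mem_uIcc).deriv, mul_comm]
    rw [e1] at hibp
    simp only [mul_comm (_root_.deriv χ _)]
    rw [hibp]
    simp
  have e1 := hK R₁ h1
  have e2 := hK R₂ (h1.trans h2)
  have e3 := intervalIntegral.integral_interval_sub_left (hint (h1.trans h2)) (hint h1)
  simp only [Pi.sub_apply] at e1 e2
  linarith

/-! ### The equations as transport equations -/

/-- The pairing `∫ u(θ) ψ(θ + s) dθ` as an inner product in `L²(S¹)`. -/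
noncomputable def pairing (u : L2S1) (ψ : C(S1, ℝ)) (s : ℝ) : ℝ := inner ℝ u (toL2 (shift ψ s))

lemma pairing_eq (u : L2S1) (ψ : C(S1, ℝ)) (s : ℝ) :
    pairing u ψ s = ∫ θ, u θ * ψ (θ + (s : S1)) := inner_toL2 _ _

lemma integrable_coe_mul (u : L2S1) (ψ : C(S1, ℝ)) (s : ℝ) :
    Integrable (fun θ => u θ * ψ (θ + (s : S1))) volume := by
  obtain ⟨C, hC⟩ := isCompact_univ.exists_bound_of_continuousOn (shift ψ s).continuous.continuousOn
  exact (integrable_coe u).mul_bdd (c := C) (shift ψ s).continuous.aestronglyMeasurable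
    (Eventually.of_forall fun c => hC c (mem_univ c))

lemma continuousOn_pairing {u : ℝ → L2S1} (hu : ContinuousOn u (Ici R₀)) (ψ : C(S1, ℝ)) (σ : ℝ) :
    ContinuousOn (fun R => pairing (u R) ψ (σ * R)) (Ici R₀) :=
  hu.inner (𝕜 := ℝ) (continuous_toL2_shift ψ σ).continuousOn

lemma integral_eq_sub_of_hasDerivWithinAt_Ici {f f' : ℝ → ℝ}
    (hf : ∀ R ∈ Ici R₀, HasDerivWithinAt f (f' R) (Ici R₀) R) (hf' : ContinuousOn f' (Ici R₀))
    {R₁ R₂ : ℝ} (h1 : R₀ ≤ R₁) (h2 : R₁ ≤ R₂) : f R₂ - f R₁ = ∫ R in R₁..R₂, f' R := by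
  refine (intervalIntegral.integral_eq_sub_of_hasDeriv_right_of_le h2 ?_ ?_ ?_).symm
  · exact fun R hR => (hf R (h1.trans hR.1)).continuousWithinAt.mono (Icc_subset_Ici_of_le h1)
  · exact fun R hR => (hf R (h1.trans hR.1.le)).mono fun s hs => (h1.trans hR.1.le).trans hs.le
  · rw [intervalIntegrable_iff_integrableOn_Ioc_of_le h2]
    exact ((hf'.mono (Icc_subset_Ici_of_le h1)).integrableOn_Icc).mono_set Ioc_subset_Icc_self

namespace Field

variable (V : Field R₀) {ψ : S1 → ℝ} (hψ : SmoothOnCircle ψ) (σ : ℝ)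

lemma hasDerivWithinAt_pairing_val {R : ℝ} (hR : R ∈ Ici R₀) :
    HasDerivWithinAt (fun R => pairing (V.val R) ⟨ψ, hψ.continuous⟩ (σ * R))
      (pairing (V.dR R) ⟨ψ, hψ.continuous⟩ (σ * R) -
        σ * pairing (V.dθ R) ⟨ψ, hψ.continuous⟩ (σ * R)) (Ici R₀) R := by
  have h1 := (V.hasDerivWithinAt R hR).inner ℝ (hasDerivAt_toL2_shift hψ σ R).hasDerivWithinAt
  rw [inner_smul_right, (V.hasWeakDeriv R hR).inner_shift hψ] at h1
  refine h1.congr_deriv ?_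
  simp only [pairing]
  ring

lemma pairing_dθ {R : ℝ} (hR : R ∈ Ici R₀) (s : ℝ) :
    pairing (V.dθ R) ⟨ψ, hψ.continuous⟩ s =
      - pairing (V.val R) ⟨dTheta ψ, hψ.dTheta.continuous⟩ s := by
  simp only [pairing]
  rw [(V.hasWeakDeriv R hR).inner_shift hψ, neg_neg]

/-- Although `V_θ` need not be differentiable in `R`, its pairing with a smooth function is: the
`θ`-derivative is moved to the test function. -/
lemma hasDerivWithinAt_pairing_dθ {R : ℝ} (hR : R ∈ Ici R₀) :
    HasDerivWithinAt (fun R => pairing (V.dθ R) ⟨ψ, hψ.continuous⟩ (σ * R))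
      (-(pairing (V.dR R) ⟨dTheta ψ, hψ.dTheta.continuous⟩ (σ * R) -
        σ * pairing (V.dθ R) ⟨dTheta ψ, hψ.dTheta.continuous⟩ (σ * R))) (Ici R₀) R :=
  (V.hasDerivWithinAt_pairing_val hψ.dTheta σ hR).neg.congr
    (fun _ hr => V.pairing_dθ hψ hr _) (V.pairing_dθ hψ hR _)

/-- `∂_R U - σ ∂_θ U = U_R - σ U_θ`, tested against functions transported along the lines
`θ + σR = const`. -/
lemma transport_val {ψ : S1 → ℝ} (hψ : SmoothOnCircle ψ) {R₁ R₂ : ℝ} (h1 : R₀ ≤ R₁) (h2 : R₁ ≤ R₂) :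
    (∫ θ, V.val R₂ θ * ψ (θ + ((σ * R₂ : ℝ) : S1))) -
        ∫ θ, V.val R₁ θ * ψ (θ + ((σ * R₁ : ℝ) : S1)) =
      ∫ R in R₁..R₂, ∫ θ, (V.dR R θ - σ * V.dθ R θ) * ψ (θ + ((σ * R : ℝ) : S1)) := by
  have h := integral_eq_sub_of_hasDerivWithinAt_Ici
    (fun R hR => V.hasDerivWithinAt_pairing_val hψ σ hR)
    ((continuousOn_pairing V.continuousOn_dR _ σ).sub
      (continuousOn_const.mul (continuousOn_pairing V.continuousOn_dθ _ σ))) h1 h2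
  rw [pairing_eq, pairing_eq] at h
  refine h.trans (intervalIntegral.integral_congr fun R _ => ?_)
  simp only [pairing_eq, ContinuousMap.coe_mk]
  have h3 := integral_sub (integrable_coe_mul (V.dR R) ⟨ψ, hψ.continuous⟩ (σ * R))
    ((integrable_coe_mul (V.dθ R) ⟨ψ, hψ.continuous⟩ (σ * R)).const_mul σ)
  rw [integral_const_mul] at h3
  refine h3.symm.trans (integral_congr_ae (Eventually.of_forall fun θ => ?_))
  simp only [ContinuousMap.coe_mk]
  ring

end Field

lemma isTestFunction_of_radial {χ : ℝ → ℝ} (hχ : IsRadialTest R₀ χ) {ψ : S1 → ℝ}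
    (hψ : SmoothOnCircle ψ) (σ : ℝ) :
    IsTestFunction R₀ (fun R θ => χ R * ψ (θ + ((σ * R : ℝ) : S1))) := by
  constructor
  · have h2 : ContDiff ℝ ∞ fun p : ℝ × ℝ => (fun r : ℝ => ψ (r : S1)) (p.2 + σ * p.1) :=
      ContDiff.comp (g := fun r : ℝ => ψ (r : S1)) hψ
        (contDiff_snd.add (contDiff_const.mul contDiff_fst))
    simp only [AddCircle.coe_add] at h2
    exact (hχ.smooth.comp contDiff_fst).mul h2
  · obtain ⟨a, b, ha, hab⟩ := hχ.support
    exact ⟨a, b, ha, fun R hR θ => by rw [hab R hR, zero_mul]⟩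

/-- The divergence-form wave equation `(m V_R)_R - (m V_θ)_θ = S` on `(R₀, ∞) × S¹` in the sense of
distributions. -/
def WeakWave (m : ℝ → ℝ) (V : Field R₀) (S : ℝ → S1 → ℝ) : Prop :=
  ∀ φ : ℝ → S1 → ℝ, IsTestFunction R₀ φ →
    ∫ R in Ioi R₀, ∫ θ : S1,
        (- (m R * V.dR R θ) * deriv (fun r => φ r θ) R + m R * V.dθ R θ * dTheta (φ R) θ)
      = ∫ R in Ioi R₀, ∫ θ : S1, S R θ * φ R θ

/-- Factorization of the wave operator: if `(m V_R)_R - (m V_θ)_θ = S` and `σ² = 1`, then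
`(∂_R - σ ∂_θ)(m (V_R + σ V_θ)) = S + σ m' V_θ`, tested against functions transported along the
lines `θ + σR = const`. -/
lemma WeakWave.transport {m m' : ℝ → ℝ} {V : Field R₀} {S : ℝ → S1 → ℝ} (hW : WeakWave m V S)
    (hm : ∀ R ∈ Ici R₀, HasDerivAt m (m' R) R) (hm' : ContinuousOn m' (Ici R₀))
    {σ : ℝ} (hσ : σ ^ 2 = 1) {ψ : S1 → ℝ} (hψ : SmoothOnCircle ψ)
    (hS : ∀ R ∈ Ici R₀, Integrable (S R) volume)
    (hSψ : ∀ b, IntegrableOn (fun R => ∫ θ, S R θ * ψ (θ + ((σ * R : ℝ) : S1))) (Ioc R₀ b))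
    {R₁ R₂ : ℝ} (h1 : R₀ ≤ R₁) (h2 : R₁ ≤ R₂) :
    (∫ θ, m R₂ * (V.dR R₂ θ + σ * V.dθ R₂ θ) * ψ (θ + ((σ * R₂ : ℝ) : S1))) -
        ∫ θ, m R₁ * (V.dR R₁ θ + σ * V.dθ R₁ θ) * ψ (θ + ((σ * R₁ : ℝ) : S1)) =
      ∫ R in R₁..R₂, ∫ θ, (S R θ + σ * m' R * V.dθ R θ) * ψ (θ + ((σ * R : ℝ) : S1)) := by
  set Ψ : C(S1, ℝ) := ⟨ψ, hψ.continuous⟩ with hΨ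
  set Ψ' : C(S1, ℝ) := ⟨dTheta ψ, hψ.dTheta.continuous⟩ with hΨ'
  set γ : ℝ → ℝ := fun R => ∫ θ, S R θ * ψ (θ + ((σ * R : ℝ) : S1)) with hγ
  have hmc : ContinuousOn m (Ici R₀) := fun R hR => (hm R hR).continuousAt.continuousWithinAt
  have cR := continuousOn_pairing V.continuousOn_dR
  have cθ := continuousOn_pairing V.continuousOn_dθ
  set β : ℝ → ℝ := fun R => m R * (σ * pairing (V.dR R) Ψ' (σ * R) - pairing (V.dθ R) Ψ' (σ * R))
    with hβ
  have hβc : ContinuousOn β (Ici R₀) := hmc.mul ((continuousOn_const.mul (cR Ψ' σ)).sub (cθ Ψ' σ))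
  have hαc : ContinuousOn (fun R => m R * pairing (V.dR R) Ψ (σ * R)) (Ici R₀) := hmc.mul (cR Ψ σ)
  have hβi := integrableOn_Ioc_of_continuousOn_Ici hβc
  -- the equation determines the distributional derivative of the pairing with `m V_R`
  have hα := sub_eq_integral_of_forall_test hαc (δ := fun R => γ R + β R)
    (fun b => (hSψ b).add (hβi b)) (fun χ hχ => by
      have hw := hW _ (isTestFunction_of_radial hχ hψ σ)
      have hL : ∀ R, ∫ θ : S1, (- (m R * V.dR R θ) *
            deriv (fun r => χ r * ψ (θ + ((σ * r : ℝ) : S1))) R +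
            m R * V.dθ R θ * dTheta (fun θ => χ R * ψ (θ + ((σ * R : ℝ) : S1))) θ) =
          -(deriv χ R * (m R * pairing (V.dR R) Ψ (σ * R))) - χ R * β R := by
        intro R
        have d1 : ∀ θ : S1, deriv (fun r => χ r * ψ (θ + ((σ * r : ℝ) : S1))) R =
            deriv χ R * ψ (θ + ((σ * R : ℝ) : S1)) +
              χ R * (dTheta ψ (θ + ((σ * R : ℝ) : S1)) * σ) := by
          intro θ
          have e1 : HasDerivAt (fun r : ℝ => ψ (θ + ((σ * r : ℝ) : S1)))
              (dTheta ψ (θ + ((σ * R : ℝ) : S1)) * σ) R := by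
            have := HasDerivAt.comp (h₂ := fun s : ℝ => ψ (θ + (s : S1))) R
              (hψ.hasDerivAt θ (σ * R)) ((hasDerivAt_id R).const_mul σ)
            simpa [Function.comp_def] using this
          exact ((hχ.hasDerivAt R).mul e1).deriv
        have d2 : ∀ θ : S1, dTheta (fun θ => χ R * ψ (θ + ((σ * R : ℝ) : S1))) θ =
            χ R * dTheta ψ (θ + ((σ * R : ℝ) : S1)) := by
          intro θ
          rw [← dTheta_translate hψ]
          unfold dTheta
          exact deriv_const_mul_field _
        have j1 := integrable_coe_mul (V.dR R) Ψ (σ * R)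
        have j2 := integrable_coe_mul (V.dR R) Ψ' (σ * R)
        have j3 := integrable_coe_mul (V.dθ R) Ψ' (σ * R)
        simp only [hβ, pairing_eq]
        calc _ = ∫ θ, ((-(m R * deriv χ R)) * (V.dR R θ * Ψ (θ + ((σ * R : ℝ) : S1))) +
              (-(m R * χ R * σ)) * (V.dR R θ * Ψ' (θ + ((σ * R : ℝ) : S1))) +
              (m R * χ R) * (V.dθ R θ * Ψ' (θ + ((σ * R : ℝ) : S1)))) := by
              refine integral_congr_ae (Eventually.of_forall fun θ => ?_)
              simp only [d1, d2, hΨ, hΨ', ContinuousMap.coe_mk]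
              ring
          _ = _ := by
              refine (integral_add ((j1.const_mul _).add (j2.const_mul _))
                (j3.const_mul _)).trans ?_
              refine (congrArg (· + _) (integral_add (j1.const_mul _) (j2.const_mul _))).trans ?_
              simp only [integral_const_mul]
              ring
      have hRt : ∀ R, ∫ θ : S1, S R θ * (χ R * ψ (θ + ((σ * R : ℝ) : S1))) = χ R * γ R := by
        intro R
        simp only [hγ]
        rw [← integral_const_mul]
        congr 1; funext θ; ring
      simp only [hL, hRt] at hw
      have i1 := hχ.deriv.integrableOn_mul (integrableOn_Ioc_of_continuousOn_Ici hαc)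
      have i2 := hχ.integrableOn_mul hβi
      have i3 := hχ.integrableOn_mul hSψ
      rw [integral_sub (f := fun R => -(deriv χ R * (m R * pairing (V.dR R) Ψ (σ * R)))) i1.neg i2,
        integral_neg] at hw
      simp only [mul_add]
      rw [integral_add i3 i2]
      linarith) h1 h2
  -- the pairing with `m V_θ` is continuously differentiable, since `V_{θR} = V_{Rθ}`
  have hκ := integral_eq_sub_of_hasDerivWithinAt_Ici
    (fun R hR => ((hm R hR).hasDerivWithinAt.mul
      (V.hasDerivWithinAt_pairing_dθ hψ σ hR)).const_mul σ)
    (continuousOn_const.mul ((hm'.mul (cθ Ψ σ)).add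
      (hmc.mul ((cR Ψ' σ).sub (continuousOn_const.mul (cθ Ψ' σ))).neg))) h1 h2
  have hP : ∀ R, ∫ θ, m R * (V.dR R θ + σ * V.dθ R θ) * ψ (θ + ((σ * R : ℝ) : S1)) =
      m R * pairing (V.dR R) Ψ (σ * R) + σ * (m R * pairing (V.dθ R) Ψ (σ * R)) := by
    intro R
    rw [pairing_eq, pairing_eq, ← integral_const_mul, ← integral_const_mul, ← integral_const_mul,
      ← integral_add ((integrable_coe_mul _ Ψ _).const_mul _)
        (((integrable_coe_mul _ Ψ _).const_mul _).const_mul _)]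
    refine integral_congr_ae (Eventually.of_forall fun θ => ?_)
    simp only [hΨ, ContinuousMap.coe_mk]
    ring
  have k1 : IntervalIntegrable (fun R => γ R + β R) volume R₁ R₂ :=
    (intervalIntegrable_iff_integrableOn_Ioc_of_le h2).2
      (((hSψ R₂).add (hβi R₂)).mono_set (Ioc_subset_Ioc_left h1))
  rw [hP, hP, add_sub_add_comm, hα]
  simp only [Pi.mul_apply] at hκ
  rw [hκ, ← intervalIntegral.integral_add k1]
  · refine intervalIntegral.integral_congr fun R hR => ?_
    rw [uIcc_of_le h2] at hR
    have hR0 : R ∈ Ici R₀ := h1.trans hR.1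
    have e1 : ∫ θ, (S R θ + σ * m' R * V.dθ R θ) * ψ (θ + ((σ * R : ℝ) : S1)) =
        γ R + σ * m' R * pairing (V.dθ R) Ψ (σ * R) := by
      have j0 : Integrable (fun θ => S R θ * ψ (θ + ((σ * R : ℝ) : S1))) volume := by
        obtain ⟨C, hC⟩ := isCompact_univ.exists_bound_of_continuousOn
          (shift Ψ (σ * R)).continuous.continuousOn
        exact (hS R hR0).mul_bdd (c := C) (shift Ψ (σ * R)).continuous.aestronglyMeasurable
          (Eventually.of_forall fun c => hC c (mem_univ c))
      rw [pairing_eq, ← integral_const_mul, hγ,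
        ← integral_add j0 ((integrable_coe_mul _ Ψ _).const_mul _)]
      refine integral_congr_ae (Eventually.of_forall fun θ => ?_)
      simp only [hΨ, ContinuousMap.coe_mk]
      ring
    simp only [e1, hβ]
    linear_combination (m R * pairing (V.dθ R) Ψ' (σ * R)) * hσ
  · rw [intervalIntegrable_iff_integrableOn_Ioc_of_le h2]
    exact (integrableOn_Ioc_of_continuousOn_Ici (continuousOn_const.mul ((hm'.mul (cθ Ψ σ)).add
      (hmc.mul ((cR Ψ' σ).sub (continuousOn_const.mul (cθ Ψ' σ))).neg))) R₂).mono_set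
      (Ioc_subset_Ioc_left h1)

/-! ### Calculus along a characteristic and integrability of the densities -/

lemma absolutelyContinuousOnInterval_const (k a b : ℝ) :
    AbsolutelyContinuousOnInterval (fun _ : ℝ => k) a b :=
  ((LipschitzWith.const k).lipschitzOnWith (s := uIcc a b)).absolutelyContinuousOnInterval

lemma absolutelyContinuousOnInterval_exp_comp {f : ℝ → ℝ} {a b : ℝ}
    (hf : AbsolutelyContinuousOnInterval f a b) :
    AbsolutelyContinuousOnInterval (fun x => exp (f x)) a b := by
  obtain ⟨C, hC⟩ := hf.exists_bound
  obtain ⟨K, hK⟩ := (Real.contDiff_exp (n := 1)).contDiffOn.exists_lipschitzOnWith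
    (by decide) (convex_Icc (-C) C) isCompact_Icc
  have hmem : ∀ x ∈ uIcc a b, f x ∈ Icc (-C) C := fun x hx => abs_le.1 (hC x hx)
  have hf0 : Tendsto (fun E : ℕ × (ℕ → ℝ × ℝ) =>
      (K : ℝ) * ∑ i ∈ Finset.range E.1, dist (f (E.2 i).1) (f (E.2 i).2))
      (AbsolutelyContinuousOnInterval.totalLengthFilter ⊓
        𝓟 (AbsolutelyContinuousOnInterval.disjWithin a b)) (𝓝 0) := by
    simpa using Tendsto.const_mul (K : ℝ) hf
  refine squeeze_zero' (Eventually.of_forall fun E => Finset.sum_nonneg fun _ _ => dist_nonneg)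
    ?_ hf0
  filter_upwards [mem_inf_of_right (mem_principal_self _)] with E hE
  rw [Finset.mul_sum]
  refine Finset.sum_le_sum fun i hi => ?_
  exact hK.dist_le_mul _ (hmem _ (hE.1 i hi).1) _ (hmem _ (hE.1 i hi).2)

/-- Along a single characteristic, the null energy density is
`T = R⁻² (X - b)² + e^{4u} Z² / 4`, with `X = R(U_R + σ U_θ)` and `Z = R⁻¹(A_R + σ A_θ)`.
If `X`, `Z` and `u` are absolutely continuous, so is `T`, and the chain rule holds. -/
lemma nullEnergy_chain_rule {a c b : ℝ} (ha : 0 < a) (hac : a ≤ c) {x₀ z₀ u₀ : ℝ}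
    {f g h : ℝ → ℝ} (hf : IntervalIntegrable f volume a c)
    (hg : IntervalIntegrable g volume a c) (hh : IntervalIntegrable h volume a c)
    {X Z u : ℝ → ℝ} (hX : ∀ R, X R = x₀ + ∫ r in a..R, f r) (hZ : ∀ R, Z R = z₀ + ∫ r in a..R, g r)
    (hu : ∀ R, u R = u₀ + ∫ r in a..R, h r) :
    (c⁻¹ ^ 2 * (X c - b) ^ 2 + exp (4 * u c) * Z c ^ 2 / 4) -
        (a⁻¹ ^ 2 * (X a - b) ^ 2 + exp (4 * u a) * Z a ^ 2 / 4) =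
      ∫ R in a..c, (-2 * R⁻¹ ^ 3 * (X R - b) ^ 2 + 2 * R⁻¹ ^ 2 * (X R - b) * f R +
        exp (4 * u R) * Z R ^ 2 * h R + exp (4 * u R) * Z R * g R / 2) := by
  obtain rfl : X = fun R => x₀ + ∫ r in a..R, f r := funext hX
  obtain rfl : Z = fun R => z₀ + ∫ r in a..R, g r := funext hZ
  obtain rfl : u = fun R => u₀ + ∫ r in a..R, h r := funext hu
  have hAC : ∀ {k : ℝ → ℝ} (k₀ : ℝ), IntervalIntegrable k volume a c →
      AbsolutelyContinuousOnInterval (fun R => k₀ + ∫ r in a..R, k r) a c := fun k₀ hk =>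
    (absolutelyContinuousOnInterval_const k₀ a c).fun_add
      (hk.absolutelyContinuousOnInterval_intervalIntegral left_mem_uIcc)
  have hpos : ∀ R ∈ uIcc a c, R ≠ 0 := fun R hR => by
    rw [uIcc_of_le hac] at hR; exact (ha.trans_le hR.1).ne'
  have hinv : AbsolutelyContinuousOnInterval (fun R : ℝ => R⁻¹) a c :=
    ContDiffOn.absolutelyContinuousOnInterval
      (fun R hR => (contDiffAt_inv ℝ (hpos R hR)).contDiffWithinAt)
  have hXb : AbsolutelyContinuousOnInterval (fun R => x₀ + (∫ r in a..R, f r) - b) a c :=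
    (hAC x₀ hf).fun_sub (absolutelyContinuousOnInterval_const b a c)
  have hexp := absolutelyContinuousOnInterval_exp_comp ((hAC u₀ hh).const_mul 4)
  have hT := ((hinv.fun_mul hinv).fun_mul (hXb.fun_mul hXb)).fun_add
    ((hexp.fun_mul ((hAC z₀ hg).fun_mul (hAC z₀ hg))).const_mul (1 / 4))
  have key := hT.integral_deriv_eq_sub
  have e : ∀ R : ℝ, R⁻¹ ^ 2 * (x₀ + (∫ r in a..R, f r) - b) ^ 2 +
      exp (4 * (u₀ + ∫ r in a..R, h r)) * (z₀ + ∫ r in a..R, g r) ^ 2 / 4 =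
      R⁻¹ * R⁻¹ * ((x₀ + (∫ r in a..R, f r) - b) * (x₀ + (∫ r in a..R, f r) - b)) +
      1 / 4 * (exp (4 * (u₀ + ∫ r in a..R, h r)) *
        ((z₀ + ∫ r in a..R, g r) * (z₀ + ∫ r in a..R, g r))) := fun R => by ring
  rw [e c, e a, ← key]
  refine intervalIntegral.integral_congr_ae ?_
  filter_upwards [hf.ae_hasDerivAt_integral, hg.ae_hasDerivAt_integral,
    hh.ae_hasDerivAt_integral] with R h1 h2 h3 hR
  have hR' := uIoc_subset_uIcc hR
  have d1 := ((h1 hR' a left_mem_uIcc).const_add x₀).sub_const b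
  have d2 := (h2 hR' a left_mem_uIcc).const_add z₀
  have d3 := (((h3 hR' a left_mem_uIcc).const_add u₀).const_mul 4).exp
  have d4 := hasDerivAt_inv (hpos R hR')
  have d := ((d4.fun_mul d4).fun_mul (d1.fun_mul d1)).fun_add
    ((d3.fun_mul (d2.fun_mul d2)).const_mul (1 / 4))
  refine (d.deriv.trans ?_)
  have := hpos R hR'
  field_simp
  ring

/-- If for every `R` the increment of `p` along almost every characteristic is the integral of `f`,
then along almost every characteristic this holds for almost every `R`. -/
lemma ae_ae_sub_eq_integral {σ R₁ R₂ : ℝ} {p f : ℝ → S1 → ℝ}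
    (hp : Measurable (Function.uncurry p)) (hf : Measurable (Function.uncurry f))
    (h : ∀ R ∈ Icc R₁ R₂, ∀ᵐ c : S1, p R (c - ((σ * R : ℝ) : S1)) -
      p R₁ (c - ((σ * R₁ : ℝ) : S1)) = ∫ r in R₁..R, f r (c - ((σ * r : ℝ) : S1))) :
    ∀ᵐ c : S1, ∀ᵐ R ∂(volume.restrict (Ioc R₁ R₂)), p R (c - ((σ * R : ℝ) : S1)) -
      p R₁ (c - ((σ * R₁ : ℝ) : S1)) = ∫ r in R₁..R, f r (c - ((σ * r : ℝ) : S1)) := by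
  have hmk : Measurable ((↑) : ℝ → S1) := AddCircle.measurable_mk'
  have hG : Measurable fun q : ℝ × S1 =>
      ∫ r, (Ioc R₁ q.1).indicator (fun r => f r (q.2 - ((σ * r : ℝ) : S1))) r := by
    have hs : MeasurableSet {z : (ℝ × S1) × ℝ | z.2 ∈ Ioc R₁ z.1.1} :=
      (measurableSet_lt measurable_const measurable_snd).inter
        (measurableSet_le measurable_snd measurable_fst.fst)
    have hm : Measurable fun z : (ℝ × S1) × ℝ => f z.2 (z.1.2 - ((σ * z.2 : ℝ) : S1)) :=
      hf.comp (measurable_snd.prodMk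
        (measurable_fst.snd.sub (hmk.comp (measurable_snd.const_mul σ))))
    exact ((hm.indicator hs).stronglyMeasurable.integral_prod_right').measurable
  have hset : MeasurableSet {q : ℝ × S1 | p q.1 (q.2 - ((σ * q.1 : ℝ) : S1)) -
      p R₁ (q.2 - ((σ * R₁ : ℝ) : S1)) =
        ∫ r, (Ioc R₁ q.1).indicator (fun r => f r (q.2 - ((σ * r : ℝ) : S1))) r} := by
    refine measurableSet_eq_fun (Measurable.sub ?_ ?_) hG
    · exact hp.comp (measurable_fst.prodMk
        (measurable_snd.sub (hmk.comp (measurable_fst.const_mul σ))))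
    · exact hp.comp (measurable_const.prodMk (measurable_snd.sub measurable_const))
  have h1 : ∀ᵐ R ∂(volume.restrict (Ioc R₁ R₂)), ∀ᵐ c : S1, p R (c - ((σ * R : ℝ) : S1)) -
      p R₁ (c - ((σ * R₁ : ℝ) : S1)) =
        ∫ r, (Ioc R₁ R).indicator (fun r => f r (c - ((σ * r : ℝ) : S1))) r := by
    filter_upwards [ae_restrict_mem measurableSet_Ioc] with R hR
    filter_upwards [h R (Ioc_subset_Icc_self hR)] with c hc
    rw [hc, integral_indicator measurableSet_Ioc, intervalIntegral.integral_of_le hR.1.le]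
  rw [Measure.ae_ae_comm hset] at h1
  filter_upwards [h1] with c hc
  filter_upwards [hc, ae_restrict_mem measurableSet_Ioc] with R hR hm
  rw [hR, integral_indicator measurableSet_Ioc, intervalIntegral.integral_of_le hm.1.le]

/-- The density `(U_R + σ U_θ - b/R)² + e^{4U}/(4R²) (A_R + σ A_θ)²` of the energy travelling in
one null direction, as a function of the values `R, U, U_R, U_θ, A_R, A_θ`. -/
noncomputable def nullEnergy (σ b R u ur ut ar at' : ℝ) : ℝ :=
  (ur + σ * ut - b * R⁻¹) ^ 2 + exp (4 * u) / (4 * R ^ 2) * (ar + σ * at') ^ 2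

/-- The rate at which `nullEnergy` decreases along its characteristics. It is only quadratic in the
derivatives. -/
noncomputable def nullLoss (σ b R u ur ut ar at' : ℝ) : ℝ :=
  2 / R * ((ur + σ * ut - b * R⁻¹) * (ur - b * R⁻¹) +
    exp (4 * u) / (4 * R ^ 2) * (σ * (ar + σ * at') * at' + 2 * b * (ar ^ 2 - at' ^ 2)))

/-- Data of finite energy on a measure space: the derivatives `ur, ut, ar, at'` are square
integrable, and the radius `ρ`, its inverse and `e^{2u}` are essentially bounded. It is used both for
a circle, with constant `ρ`, and for a slab, where `ρ` is the coordinate `R`. -/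
structure FiniteEnergy {X : Type*} [MeasurableSpace X] (μ : Measure X)
    (ρ u ur ut ar at' : X → ℝ) : Prop where
  inv_radius : MemLp (fun x => (ρ x)⁻¹) ⊤ μ
  radius : MemLp ρ ⊤ μ
  exp_two : MemLp (fun x => exp (2 * u x)) ⊤ μ
  ur : MemLp ur 2 μ
  ut : MemLp ut 2 μ
  ar : MemLp ar 2 μ
  at' : MemLp at' 2 μ

lemma memLp_two_mul_integrable {X : Type*} [MeasurableSpace X] {μ : Measure X} {f g : X → ℝ}
    (hf : MemLp f 2 μ) (hg : MemLp g 2 μ) : Integrable (fun x => f x * g x) μ :=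
  hf.integrable_mul hg

lemma memLp_top_mul {X : Type*} [MeasurableSpace X] {μ : Measure X} {k f : X → ℝ} {p : ENNReal}
    (hk : MemLp k ⊤ μ) (hf : MemLp f p μ) : MemLp (fun x => k x * f x) p μ := hf.mul hk

lemma memLp_top_exp_two {X : Type*} [MeasurableSpace X] {μ : Measure X} {u : X → ℝ} {C : ℝ}
    (hu : AEStronglyMeasurable u μ) (hC : ∀ᵐ x ∂μ, |u x| ≤ C) :
    MemLp (fun x => exp (2 * u x)) ⊤ μ := by
  refine memLp_top_of_bound
    (Real.continuous_exp.comp_aestronglyMeasurable (hu.const_mul 2)) (exp (2 * C)) ?_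
  filter_upwards [hC] with x hx
  rw [Real.norm_eq_abs, abs_exp, exp_le_exp]
  linarith [le_abs_self (u x)]

lemma exp_four_mul (x : ℝ) : exp (4 * x) = exp (2 * x) * exp (2 * x) := by
  rw [← exp_add]; ring_nf

namespace FiniteEnergy

variable {X : Type*} [MeasurableSpace X] {μ : Measure X} {ρ u ur ut ar at' : X → ℝ}

/-- The weight `e^{2U}/R` turns the derivatives of `A` into square integrable functions. -/
lemma weighted {f : X → ℝ} (D : FiniteEnergy μ ρ u ur ut ar at') (hf : MemLp f 2 μ) :
    MemLp (fun x => exp (2 * u x) * ((ρ x)⁻¹ * f x)) 2 μ :=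
  memLp_top_mul D.exp_two (memLp_top_mul D.inv_radius hf)

lemma integrable_weighted_mul {f g : X → ℝ} (D : FiniteEnergy μ ρ u ur ut ar at')
    (hf : MemLp f 2 μ) (hg : MemLp g 2 μ) :
    Integrable (fun x => exp (4 * u x) / (4 * ρ x ^ 2) * (f x * g x)) μ := by
  refine ((memLp_two_mul_integrable (D.weighted hf) (D.weighted hg)).const_mul (1 / 4)).congr
    (Eventually.of_forall fun x => ?_)
  simp only [exp_four_mul]
  ring

lemma integrable_weighted_quadratic (D : FiniteEnergy μ ρ u ur ut ar at') (α β γ : ℝ) :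
    Integrable (fun x => exp (4 * u x) / (4 * ρ x ^ 2) *
      (α * ar x ^ 2 + β * at' x ^ 2 + γ * (ar x * at' x))) μ := by
  refine ((((D.integrable_weighted_mul D.ar D.ar).const_mul α).add
    ((D.integrable_weighted_mul D.at' D.at').const_mul β)).add
    ((D.integrable_weighted_mul D.ar D.at').const_mul γ)).congr (Eventually.of_forall fun x => ?_)
  simp only [Pi.add_apply]
  ring

lemma integrable_sourceU (D : FiniteEnergy μ ρ u ur ut ar at') :
    Integrable (fun x => 2 * ρ x * (exp (4 * u x) / (4 * ρ x ^ 2) * (ar x ^ 2 - at' x ^ 2))) μ := by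
  refine ((((memLp_two_mul_integrable (memLp_top_mul D.radius (D.weighted D.ar))
    (D.weighted D.ar))).sub (memLp_two_mul_integrable (memLp_top_mul D.radius (D.weighted D.at'))
    (D.weighted D.at'))).const_mul (1 / 2)).congr (Eventually.of_forall fun x => ?_)
  simp only [Pi.sub_apply, exp_four_mul]
  ring

lemma integrable_sourceA (D : FiniteEnergy μ ρ u ur ut ar at') :
    Integrable (fun x => exp (-2 * u x) *
      (4 * exp (2 * u x) / ρ x * (-(ur x * ar x) + ut x * at' x))) μ := by
  refine (((memLp_two_mul_integrable (memLp_top_mul D.inv_radius D.ut) D.at').sub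
    (memLp_two_mul_integrable (memLp_top_mul D.inv_radius D.ur) D.ar)).const_mul 4).congr
    (Eventually.of_forall fun x => ?_)
  have h : exp (-2 * u x) * exp (2 * u x) = 1 := by rw [← exp_add]; simp
  simp only [Pi.sub_apply]
  linear_combination (-4 * (ρ x)⁻¹ * (-(ur x * ar x) + ut x * at' x)) * h

lemma integrable_dissipation (D : FiniteEnergy μ ρ u ur ut ar at') (b : ℝ) :
    Integrable (fun x => 2 / ρ x * (exp (4 * u x) / (4 * ρ x ^ 2) *
      (2 * b * ar x ^ 2 + (1 - 2 * b) * at' x ^ 2))) μ := by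
  have h : ∀ {f : X → ℝ}, MemLp f 2 μ →
      Integrable (fun x => 2 / ρ x * (exp (4 * u x) / (4 * ρ x ^ 2) * f x ^ 2)) μ := by
    intro f hf
    refine ((memLp_two_mul_integrable (memLp_top_mul D.inv_radius (D.weighted hf))
      (D.weighted hf)).const_mul (1 / 2)).congr (Eventually.of_forall fun x => ?_)
    simp only [exp_four_mul]
    ring
  refine (((h D.ar).const_mul (2 * b)).add ((h D.at').const_mul (1 - 2 * b))).congr
    (Eventually.of_forall fun x => ?_)
  simp only [Pi.add_apply]
  ring

variable [IsFiniteMeasure μ]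

lemma memLp_nullDerivative (D : FiniteEnergy μ ρ u ur ut ar at') (σ b : ℝ) :
    MemLp (fun x => ur x + σ * ut x - b * (ρ x)⁻¹) 2 μ :=
  (D.ur.add (D.ut.const_mul σ)).sub ((D.inv_radius.mono_exponent le_top).const_mul b)

lemma integrable_nullEnergy (D : FiniteEnergy μ ρ u ur ut ar at') (σ b : ℝ) :
    Integrable (fun x => nullEnergy σ b (ρ x) (u x) (ur x) (ut x) (ar x) (at' x)) μ := by
  refine ((D.memLp_nullDerivative σ b).integrable_sq.add
    (D.integrable_weighted_quadratic 1 (σ ^ 2) (2 * σ))).congr (Eventually.of_forall fun x => ?_)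
  simp only [Pi.add_apply, nullEnergy]
  ring

lemma integrable_nullLoss (D : FiniteEnergy μ ρ u ur ut ar at') (σ b : ℝ) :
    Integrable (fun x => nullLoss σ b (ρ x) (u x) (ur x) (ut x) (ar x) (at' x)) μ := by
  have h0 : MemLp (fun x => ur x - b * (ρ x)⁻¹) 2 μ := by
    simpa using D.memLp_nullDerivative 0 b
  have h1 := ((memLp_two_mul_integrable (D.memLp_nullDerivative σ b) h0).add
    (D.integrable_weighted_quadratic (2 * b) (σ ^ 2 - 2 * b) σ))
  have h2 := h1.bdd_mul D.inv_radius.1 (c := (eLpNorm (fun x => (ρ x)⁻¹) ⊤ μ).toReal) (by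
    rw [eLpNorm_exponent_top]
    filter_upwards [ae_le_eLpNormEssSup (f := fun x => (ρ x)⁻¹) (μ := μ)] with x hx
    rw [← toReal_enorm]
    exact ENNReal.toReal_mono (by
      rw [← eLpNorm_exponent_top]; exact D.inv_radius.eLpNorm_ne_top) hx)
  refine (h2.const_mul 2).congr (Eventually.of_forall fun x => ?_)
  simp only [Pi.add_apply, nullLoss]
  ring

end FiniteEnergy

/-- The energy balance along a single characteristic of `∂_R - σ ∂_θ`. The source terms
of the equations for `X` and `Z` enter the chain rule through cubic terms, which cancel up to a
multiple of `σ² - 1`. -/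
lemma nullEnergy_sub_eq_integral_nullLoss {σ b a c : ℝ} (ha : 0 < a) (hac : a ≤ c) (hσ : σ ^ 2 = 1)
    {u ur ut ar at' f g h : ℝ → ℝ}
    (hf : ∀ R, f R = 2 * R * (exp (4 * u R) / (4 * R ^ 2) * (ar R ^ 2 - at' R ^ 2)) +
      σ * 1 * ut R)
    (hg : ∀ R, g R = exp (-2 * u R) * (4 * exp (2 * u R) / R * (-(ur R * ar R) + ut R * at' R)) +
      σ * -(R ^ 2)⁻¹ * at' R)
    (hh : ∀ R, h R = ur R - σ * ut R)
    (hfi : IntervalIntegrable f volume a c) (hgi : IntervalIntegrable g volume a c)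
    (hhi : IntervalIntegrable h volume a c)
    (hX : ∀ᵐ R ∂(volume.restrict (Ioc a c)),
      R * (ur R + σ * ut R) - a * (ur a + σ * ut a) = ∫ r in a..R, f r)
    (hXc : c * (ur c + σ * ut c) - a * (ur a + σ * ut a) = ∫ r in a..c, f r)
    (hZ : ∀ᵐ R ∂(volume.restrict (Ioc a c)),
      R⁻¹ * (ar R + σ * at' R) - a⁻¹ * (ar a + σ * at' a) = ∫ r in a..R, g r)
    (hZc : c⁻¹ * (ar c + σ * at' c) - a⁻¹ * (ar a + σ * at' a) = ∫ r in a..c, g r)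
    (hu : ∀ᵐ R ∂(volume.restrict (Ioc a c)), u R - u a = ∫ r in a..R, h r)
    (huc : u c - u a = ∫ r in a..c, h r) :
    nullEnergy σ b c (u c) (ur c) (ut c) (ar c) (at' c) -
        nullEnergy σ b a (u a) (ur a) (ut a) (ar a) (at' a) =
      - ∫ R in a..c, nullLoss σ b R (u R) (ur R) (ut R) (ar R) (at' R) := by
  have key := nullEnergy_chain_rule (b := b) ha hac hfi hgi hhi
    (X := fun R => a * (ur a + σ * ut a) + ∫ r in a..R, f r)
    (Z := fun R => a⁻¹ * (ar a + σ * at' a) + ∫ r in a..R, g r)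
    (u := fun R => u a + ∫ r in a..R, h r) (fun _ => rfl) (fun _ => rfl) (fun _ => rfl)
  have hc : 0 < c := ha.trans_le hac
  have hT : ∀ R : ℝ, 0 < R → R⁻¹ ^ 2 * (R * (ur R + σ * ut R) - b) ^ 2 +
      exp (4 * u R) * (R⁻¹ * (ar R + σ * at' R)) ^ 2 / 4 =
      nullEnergy σ b R (u R) (ur R) (ut R) (ar R) (at' R) := by
    intro R hR
    rw [nullEnergy]
    field_simp
  simp only [intervalIntegral.integral_same, add_zero, ← hXc, ← hZc, ← huc,
    add_sub_cancel] at key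
  rw [hT c hc, hT a ha] at key
  rw [key, ← intervalIntegral.integral_neg]
  refine intervalIntegral.integral_congr_ae ?_
  rw [uIoc_of_le hac]
  filter_upwards [(ae_restrict_iff' measurableSet_Ioc).1 hX,
    (ae_restrict_iff' measurableSet_Ioc).1 hZ,
    (ae_restrict_iff' measurableSet_Ioc).1 hu] with R e1 e2 e3 hR
  have hR0 : R ≠ 0 := (ha.trans hR.1).ne'
  have hee : exp (-2 * u R) * (4 * exp (2 * u R) / R * (-(ur R * ar R) + ut R * at' R)) =
      4 / R * (-(ur R * ar R) + ut R * at' R) := by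
    have h : exp (-2 * u R) * exp (2 * u R) = 1 := by rw [← exp_add]; simp
    linear_combination (4 / R * (-(ur R * ar R) + ut R * at' R)) * h
  rw [← e1 hR, ← e2 hR, ← e3 hR, hf, hg, hh, hee]
  simp only [add_sub_cancel, nullLoss]
  field_simp
  -- what is left of the cubic terms is a multiple of `σ² - 1`
  linear_combination (8 * R * exp (4 * u R) * (ur R * at' R ^ 2 - 2 * ut R * ar R * at' R -
    σ * ut R * at' R ^ 2)) * hσ

/-! ### From the fields to their measurable versions -/

/-- Jointly measurable versions of `U` (`u`), of its derivatives `U_R`, `U_θ` (`ur`, `ut`), and of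
the derivatives `A_R`, `A_θ` (`ar`, `at'`). -/
structure Versions (U A : Field R₀) where
  u : ℝ → S1 → ℝ
  ur : ℝ → S1 → ℝ
  ut : ℝ → S1 → ℝ
  ar : ℝ → S1 → ℝ
  at' : ℝ → S1 → ℝ
  hu : IsVersion R₀ U.val u
  hur : IsVersion R₀ U.dR ur
  hut : IsVersion R₀ U.dθ ut
  har : IsVersion R₀ A.dR ar
  hat : IsVersion R₀ A.dθ at'

lemma nonempty_versions (U A : Field R₀) : Nonempty (Versions U A) := by
  obtain ⟨u, hu⟩ := exists_isVersion U.continuousOn_val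
  obtain ⟨ur, hur⟩ := exists_isVersion U.continuousOn_dR
  obtain ⟨ut, hut⟩ := exists_isVersion U.continuousOn_dθ
  obtain ⟨ar, har⟩ := exists_isVersion A.continuousOn_dR
  obtain ⟨at', hat⟩ := exists_isVersion A.continuousOn_dθ
  exact ⟨⟨u, ur, ut, ar, at', hu, hur, hut, har, hat⟩⟩

lemma memLp_top_of_mem_Icc {X : Type*} [MeasurableSpace X] {μ : Measure X} {ρ : X → ℝ} {a c : ℝ}
    (ha : 0 < a) (hm : Measurable ρ) (h : ∀ᵐ x ∂μ, ρ x ∈ Icc a c) :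
    MemLp (fun x => (ρ x)⁻¹) ⊤ μ ∧ MemLp ρ ⊤ μ := by
  constructor
  · refine memLp_top_of_bound hm.inv.aestronglyMeasurable a⁻¹ ?_
    filter_upwards [h] with x hx
    rw [Real.norm_eq_abs, abs_of_pos (inv_pos.2 (ha.trans_le hx.1))]
    exact inv_anti₀ ha hx.1
  · refine memLp_top_of_bound hm.aestronglyMeasurable c ?_
    filter_upwards [h] with x hx
    rw [Real.norm_eq_abs, abs_of_pos (ha.trans_le hx.1)]
    exact hx.2

lemma finiteEnergy_circle (hR₀ : 0 < R₀) (U A : Field R₀) {R : ℝ} (hR : R ∈ Ici R₀) :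
    FiniteEnergy volume (fun _ : S1 => R) (U.val R) (U.dR R) (U.dθ R) (A.dR R) (A.dθ R) := by
  obtain ⟨C, hC⟩ := U.exists_ae_abs_le R
  have h := memLp_top_of_mem_Icc (μ := (volume : Measure S1)) (ρ := fun _ => R) (c := R) hR₀
    measurable_const (Eventually.of_forall fun _ => ⟨hR, le_rfl⟩)
  exact ⟨h.1, h.2, memLp_top_exp_two (Lp.aestronglyMeasurable _) (hC R ⟨hR, le_rfl⟩),
    Lp.memLp _, Lp.memLp _, Lp.memLp _, Lp.memLp _⟩

namespace Versions

variable {U A : Field R₀} (D : Versions U A)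

lemma finiteEnergy_slab (hR₀ : 0 < R₀) {R₁ : ℝ} (h1 : R₀ ≤ R₁) (R₂ : ℝ) :
    FiniteEnergy (slab R₁ R₂) Prod.fst (Function.uncurry D.u) (Function.uncurry D.ur)
      (Function.uncurry D.ut) (Function.uncurry D.ar) (Function.uncurry D.at') := by
  obtain ⟨C, hC⟩ := U.exists_ae_abs_le R₂
  have h := memLp_top_of_mem_Icc (μ := slab R₁ R₂) (ρ := Prod.fst) (c := R₂) (hR₀.trans_le h1)
    measurable_fst (Measure.quasiMeasurePreserving_fst.ae (p := fun R => R ∈ Icc R₁ R₂) (by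
      filter_upwards [ae_restrict_mem measurableSet_Ioc] with R hR using Ioc_subset_Icc_self hR))
  refine ⟨h.1, h.2, memLp_top_exp_two (C := C) D.hu.measurable.aestronglyMeasurable ?_,
    D.hur.memLp_slab U.continuousOn_dR h1, D.hut.memLp_slab U.continuousOn_dθ h1,
    D.har.memLp_slab A.continuousOn_dR h1, D.hat.memLp_slab A.continuousOn_dθ h1⟩
  have hset : MeasurableSet {q : ℝ × S1 | |Function.uncurry D.u q| ≤ C} :=
    measurableSet_le D.hu.measurable.abs measurable_const
  refine (Measure.ae_prod_mem_iff_ae_ae_mem hset).2 ?_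
  filter_upwards [ae_restrict_mem measurableSet_Ioc] with R hR
  filter_upwards [hC R ⟨h1.trans hR.1.le, hR.2⟩, D.hu.ae_eq R (h1.trans hR.1.le)] with θ e1 e2
  simpa only [mem_ofPred_eq, Function.uncurry, e2] using e1

/-- The versions and the fields give the same integrals over each circle. -/
lemma integral_eq (Φ : ℝ → S1 → ℝ → ℝ → ℝ → ℝ → ℝ → ℝ) {R : ℝ} (hR : R ∈ Ici R₀) :
    ∫ θ, Φ R θ (D.u R θ) (D.ur R θ) (D.ut R θ) (D.ar R θ) (D.at' R θ) =
      ∫ θ, Φ R θ (U.val R θ) (U.dR R θ) (U.dθ R θ) (A.dR R θ) (A.dθ R θ) := by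
  refine integral_congr_ae ?_
  filter_upwards [D.hu.ae_eq R hR, D.hur.ae_eq R hR, D.hut.ae_eq R hR, D.har.ae_eq R hR,
    D.hat.ae_eq R hR] with θ e1 e2 e3 e4 e5
  rw [e1, e2, e3, e4, e5]

/-- Fubini's theorem for an integrable density, expressed through the fields. -/
lemma integrableOn_integral (Φ : ℝ → S1 → ℝ → ℝ → ℝ → ℝ → ℝ → ℝ) {R₁ R₂ : ℝ} (h1 : R₀ ≤ R₁)
    (h : Integrable (fun q : ℝ × S1 => Φ q.1 q.2 (D.u q.1 q.2) (D.ur q.1 q.2) (D.ut q.1 q.2)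
      (D.ar q.1 q.2) (D.at' q.1 q.2)) (slab R₁ R₂)) :
    IntegrableOn (fun R => ∫ θ, Φ R θ (U.val R θ) (U.dR R θ) (U.dθ R θ) (A.dR R θ) (A.dθ R θ))
      (Ioc R₁ R₂) := by
  refine h.integral_prod_left.congr ?_
  filter_upwards [ae_restrict_mem measurableSet_Ioc] with R hR
  exact D.integral_eq Φ (Ioc_subset_Ici_of_le h1 hR)

end Versions

/-- The source terms are integrable against transported test functions. -/
lemma Versions.integrableOn_integral_mul {U A : Field R₀} (D : Versions U A)
    (Φ : ℝ → ℝ → ℝ → ℝ → ℝ → ℝ → ℝ)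
    (h : ∀ R₂, Integrable (fun q : ℝ × S1 => Φ q.1 (D.u q.1 q.2) (D.ur q.1 q.2) (D.ut q.1 q.2)
      (D.ar q.1 q.2) (D.at' q.1 q.2)) (slab R₀ R₂)) {ψ : S1 → ℝ} (hψ : SmoothOnCircle ψ) (σ b : ℝ) :
    IntegrableOn (fun R => ∫ θ, Φ R (U.val R θ) (U.dR R θ) (U.dθ R θ) (A.dR R θ) (A.dθ R θ) *
      ψ (θ + ((σ * R : ℝ) : S1))) (Ioc R₀ b) := by
  obtain ⟨C, hC⟩ := isCompact_univ.exists_bound_of_continuousOn hψ.continuous.continuousOn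
  have hc : Continuous fun q : ℝ × S1 => ψ (q.2 + ((σ * q.1 : ℝ) : S1)) :=
    hψ.continuous.comp (continuous_snd.add
      ((AddCircle.continuous_mk' (2 * π)).comp (continuous_const.mul continuous_fst)))
  exact D.integrableOn_integral
    (fun R θ u ur ut ar at' => Φ R u ur ut ar at' * ψ (θ + ((σ * R : ℝ) : S1))) le_rfl
    ((h b).mul_bdd (c := C) hc.aestronglyMeasurable
      (Eventually.of_forall fun q => hC _ (mem_univ _)))

/-- Passage from the tested transport identity for the fields to the identity along almost every
characteristic for the versions. -/
lemma Versions.ae_transport {U A : Field R₀} (D : Versions U A)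
    (P F : ℝ → ℝ → ℝ → ℝ → ℝ → ℝ → ℝ) {R₁ R₂ σ : ℝ} (h1 : R₀ ≤ R₁)
    (hP : ∀ R ∈ Ici R₀, Integrable
      (fun θ => P R (U.val R θ) (U.dR R θ) (U.dθ R θ) (A.dR R θ) (A.dθ R θ)) volume)
    (hPm : Measurable (fun q : ℝ × S1 =>
      P q.1 (D.u q.1 q.2) (D.ur q.1 q.2) (D.ut q.1 q.2) (D.ar q.1 q.2) (D.at' q.1 q.2)))
    (hFm : Measurable (fun q : ℝ × S1 =>
      F q.1 (D.u q.1 q.2) (D.ur q.1 q.2) (D.ut q.1 q.2) (D.ar q.1 q.2) (D.at' q.1 q.2)))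
    (hF : ∀ R, Integrable (fun q : ℝ × S1 =>
      F q.1 (D.u q.1 q.2) (D.ur q.1 q.2) (D.ut q.1 q.2) (D.ar q.1 q.2) (D.at' q.1 q.2)) (slab R₁ R))
    (h : ∀ ψ : S1 → ℝ, SmoothOnCircle ψ → ∀ R, R₁ ≤ R →
      (∫ θ, P R (U.val R θ) (U.dR R θ) (U.dθ R θ) (A.dR R θ) (A.dθ R θ) *
        ψ (θ + ((σ * R : ℝ) : S1))) -
        ∫ θ, P R₁ (U.val R₁ θ) (U.dR R₁ θ) (U.dθ R₁ θ) (A.dR R₁ θ) (A.dθ R₁ θ) *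
          ψ (θ + ((σ * R₁ : ℝ) : S1)) =
        ∫ r in R₁..R, ∫ θ, F r (U.val r θ) (U.dR r θ) (U.dθ r θ) (A.dR r θ) (A.dθ r θ) *
          ψ (θ + ((σ * r : ℝ) : S1))) :
    let p := fun R θ => P R (D.u R θ) (D.ur R θ) (D.ut R θ) (D.ar R θ) (D.at' R θ)
    let f := fun R θ => F R (D.u R θ) (D.ur R θ) (D.ut R θ) (D.ar R θ) (D.at' R θ)
    (∀ R, R₁ ≤ R → ∀ᵐ c : S1, p R (c - ((σ * R : ℝ) : S1)) - p R₁ (c - ((σ * R₁ : ℝ) : S1)) =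
      ∫ r in R₁..R, f r (c - ((σ * r : ℝ) : S1))) ∧
    (∀ᵐ c : S1, ∀ᵐ R ∂(volume.restrict (Ioc R₁ R₂)), p R (c - ((σ * R : ℝ) : S1)) -
      p R₁ (c - ((σ * R₁ : ℝ) : S1)) = ∫ r in R₁..R, f r (c - ((σ * r : ℝ) : S1))) ∧
    (∀ᵐ c : S1, IntegrableOn (fun r => f r (c - ((σ * r : ℝ) : S1))) (Ioc R₁ R₂)) := by
  intro p f
  have hp : ∀ R ∈ Ici R₀, Integrable (p R) volume := fun R hR => by
    refine (hP R hR).congr ?_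
    filter_upwards [D.hu.ae_eq R hR, D.hur.ae_eq R hR, D.hut.ae_eq R hR, D.har.ae_eq R hR,
      D.hat.ae_eq R hR] with θ e1 e2 e3 e4 e5
    simp only [p, e1, e2, e3, e4, e5]
  have hfix : ∀ R, R₁ ≤ R → ∀ᵐ c : S1, p R (c - ((σ * R : ℝ) : S1)) -
      p R₁ (c - ((σ * R₁ : ℝ) : S1)) = ∫ r in R₁..R, f r (c - ((σ * r : ℝ) : S1)) := by
    intro R hR
    refine ae_sub_eq_integral_of_transport hR (hp R₁ h1) (hp R (h1.trans hR)) (hF R) fun ψ hψ => ?_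
    have e := h ψ hψ R hR
    rw [← D.integral_eq (fun R θ u ur ut ar at' => P R u ur ut ar at' *
        ψ (θ + ((σ * R : ℝ) : S1))) (h1.trans hR),
      ← D.integral_eq (fun R θ u ur ut ar at' => P R u ur ut ar at' *
        ψ (θ + ((σ * R : ℝ) : S1))) h1] at e
    refine e.trans (intervalIntegral.integral_congr fun r hr => ?_)
    rw [uIcc_of_le hR] at hr
    exact (D.integral_eq (fun R θ u ur ut ar at' => F R u ur ut ar at' *
      ψ (θ + ((σ * R : ℝ) : S1))) (h1.trans hr.1)).symm
  refine ⟨hfix, ae_ae_sub_eq_integral hPm hFm fun R hR => hfix R hR.1, ?_⟩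
  exact ((measurePreserving_shear σ R₁ R₂).integrable_comp_of_integrable (hF R₂)).prod_left_ae

/-! ### The energy identity -/

/-- The energy balance along almost every characteristic of `∂_R - σ ∂_θ`. -/
lemma Versions.ae_nullEnergy_sub {U A : Field R₀} (D : Versions U A) (hR₀ : 0 < R₀)
    (hU : WeakEquationU U A) (hA : WeakEquationA U A) {σ : ℝ} (hσ : σ ^ 2 = 1) (b : ℝ)
    {R₁ R₂ : ℝ} (h1 : R₀ ≤ R₁) (h2 : R₁ ≤ R₂) :
    let e := fun R θ => nullEnergy σ b R (D.u R θ) (D.ur R θ) (D.ut R θ) (D.ar R θ) (D.at' R θ)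
    let l := fun R θ => nullLoss σ b R (D.u R θ) (D.ur R θ) (D.ut R θ) (D.ar R θ) (D.at' R θ)
    ∀ᵐ c : S1, e R₂ (c - ((σ * R₂ : ℝ) : S1)) - e R₁ (c - ((σ * R₁ : ℝ) : S1)) =
      - ∫ R in R₁..R₂, l R (c - ((σ * R : ℝ) : S1)) := by
  intro e l
  have mU : Measurable (fun q : ℝ × S1 => D.u q.1 q.2) := D.hu.measurable
  have mUr : Measurable (fun q : ℝ × S1 => D.ur q.1 q.2) := D.hur.measurable
  have mUt : Measurable (fun q : ℝ × S1 => D.ut q.1 q.2) := D.hut.measurable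
  have mAr : Measurable (fun q : ℝ × S1 => D.ar q.1 q.2) := D.har.measurable
  have mAt : Measurable (fun q : ℝ × S1 => D.at' q.1 q.2) := D.hat.measurable
  have S := fun R => D.finiteEnergy_slab hR₀ h1 R
  have S₀ := fun R => D.finiteEnergy_slab hR₀ le_rfl R
  -- the transport equation for `X = R (U_R + σ U_θ)`
  have hX := D.ae_transport (R₂ := R₂) (σ := σ) (fun R _ ur ut _ _ => R * (ur + σ * ut))
    (fun R u _ ut ar at' =>
      2 * R * (exp (4 * u) / (4 * R ^ 2) * (ar ^ 2 - at' ^ 2)) + σ * 1 * ut) h1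
    (fun R _ => (((integrable_coe (U.dR R)).add ((integrable_coe (U.dθ R)).const_mul σ))).const_mul R)
    (by fun_prop) (by fun_prop)
    (fun R => (S R).integrable_sourceU.add
      (((S R).ut.integrable (by norm_num)).const_mul (σ * 1)))
    (fun ψ hψ R hR => WeakWave.transport (m := fun R => R) (m' := fun _ => 1)
      (S := fun R θ => 2 * R * OmegaU U A R θ) hU (fun R _ => hasDerivAt_id R) continuousOn_const
      hσ hψ (fun R hR => (finiteEnergy_circle hR₀ U A hR).integrable_sourceU)
      (fun R => D.integrableOn_integral_mul (fun R u _ _ ar at' =>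
        2 * R * (exp (4 * u) / (4 * R ^ 2) * (ar ^ 2 - at' ^ 2)))
        (fun R => (S₀ R).integrable_sourceU) hψ σ R) h1 hR)
  -- the transport equation for `Z = R⁻¹ (A_R + σ A_θ)`
  have hZ := D.ae_transport (R₂ := R₂) (σ := σ) (fun R _ _ _ ar at' => R⁻¹ * (ar + σ * at'))
    (fun R u ur ut ar at' =>
      exp (-2 * u) * (4 * exp (2 * u) / R * (-(ur * ar) + ut * at')) + σ * -(R ^ 2)⁻¹ * at') h1
    (fun R _ => (((integrable_coe (A.dR R)).add ((integrable_coe (A.dθ R)).const_mul σ))).const_mul _)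
    (by fun_prop) (by fun_prop)
    (fun R => by
      refine (S R).integrable_sourceA.add ?_
      have k := (memLp_top_mul (S R).inv_radius (memLp_top_mul (S R).inv_radius (S R).at')).integrable
        (by norm_num)
      refine (k.const_mul (-σ)).congr (Eventually.of_forall fun q => ?_)
      simp only [Function.uncurry]
      ring)
    (fun ψ hψ R hR => WeakWave.transport (m := fun R => R⁻¹) (m' := fun R => -(R ^ 2)⁻¹)
      (S := fun R θ => exp (-2 * U.val R θ) * OmegaA U A R θ) hA
      (fun R hR => hasDerivAt_inv (hR₀.trans_le hR).ne')
      (ContinuousOn.neg (ContinuousOn.inv₀ (by fun_prop)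
        fun R hR => pow_ne_zero 2 (hR₀.trans_le hR).ne'))
      hσ hψ (fun R hR => (finiteEnergy_circle hR₀ U A hR).integrable_sourceA)
      (fun R => D.integrableOn_integral_mul (fun R u ur ut ar at' =>
        exp (-2 * u) * (4 * exp (2 * u) / R * (-(ur * ar) + ut * at')))
        (fun R => (S₀ R).integrable_sourceA) hψ σ R) h1 hR)
  -- the transport equation for `U` itself
  have hV := D.ae_transport (R₂ := R₂) (σ := σ) (fun _ u _ _ _ _ => u)
    (fun _ _ ur ut _ _ => ur - σ * ut) h1
    (fun R _ => integrable_coe (U.val R)) mU (by fun_prop)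
    (fun R => ((S R).ur.sub ((S R).ut.const_mul σ)).integrable (by norm_num))
    (fun ψ hψ R hR => U.transport_val σ hψ h1 hR)
  filter_upwards [hX.1 R₂ h2, hX.2.1, hX.2.2, hZ.1 R₂ h2, hZ.2.1, hZ.2.2, hV.1 R₂ h2, hV.2.1,
    hV.2.2] with c x1 x2 x3 z1 z2 z3 v1 v2 v3
  have hi := fun {k : ℝ → ℝ} => (intervalIntegrable_iff_integrableOn_Ioc_of_le (f := k)
    (μ := volume) h2).2
  exact nullEnergy_sub_eq_integral_nullLoss (b := b) (hR₀.trans_le h1) h2 hσ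
    (u := fun R => D.u R (c - ((σ * R : ℝ) : S1))) (ur := fun R => D.ur R (c - ((σ * R : ℝ) : S1)))
    (ut := fun R => D.ut R (c - ((σ * R : ℝ) : S1))) (ar := fun R => D.ar R (c - ((σ * R : ℝ) : S1)))
    (at' := fun R => D.at' R (c - ((σ * R : ℝ) : S1)))
    (fun _ => rfl) (fun _ => rfl) (fun _ => rfl) (hi x3) (hi z3) (hi v3) x2 x1 z2 z1 v2 v1

/-- The energy identity in one null direction: integrating the balance over all characteristics
involves only the quadratic loss term, which is integrable over slabs. -/
lemma integral_nullEnergy_sub {U A : Field R₀} (hR₀ : 0 < R₀)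
    (hU : WeakEquationU U A) (hA : WeakEquationA U A) {σ : ℝ} (hσ : σ ^ 2 = 1) (b : ℝ) {R₁ R₂ : ℝ}
    (h1 : R₀ ≤ R₁) (h2 : R₁ ≤ R₂) :
    IntervalIntegrable (fun R => ∫ θ, nullLoss σ b R (U.val R θ) (U.dR R θ) (U.dθ R θ) (A.dR R θ)
      (A.dθ R θ)) volume R₁ R₂ ∧
    (∫ θ, nullEnergy σ b R₂ (U.val R₂ θ) (U.dR R₂ θ) (U.dθ R₂ θ) (A.dR R₂ θ) (A.dθ R₂ θ)) -
        ∫ θ, nullEnergy σ b R₁ (U.val R₁ θ) (U.dR R₁ θ) (U.dθ R₁ θ) (A.dR R₁ θ) (A.dθ R₁ θ) =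
      - ∫ R in R₁..R₂, ∫ θ, nullLoss σ b R (U.val R θ) (U.dR R θ) (U.dθ R θ) (A.dR R θ)
        (A.dθ R θ) := by
  obtain ⟨D⟩ := nonempty_versions U A
  have S := (D.finiteEnergy_slab hR₀ h1 R₂).integrable_nullLoss σ b
  refine ⟨(intervalIntegrable_iff_integrableOn_Ioc_of_le h2).2
    (D.integrableOn_integral (fun R _ u ur ut ar at' => nullLoss σ b R u ur ut ar at') h1 S), ?_⟩
  have hE : ∀ R ∈ Ici R₀, Integrable (fun θ => nullEnergy σ b R (D.u R θ) (D.ur R θ) (D.ut R θ)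
      (D.ar R θ) (D.at' R θ)) volume := fun R hR => by
    refine ((finiteEnergy_circle hR₀ U A hR).integrable_nullEnergy σ b).congr ?_
    filter_upwards [D.hu.ae_eq R hR, D.hur.ae_eq R hR, D.hut.ae_eq R hR, D.har.ae_eq R hR,
      D.hat.ae_eq R hR] with θ e1 e2 e3 e4 e5
    rw [e1, e2, e3, e4, e5]
  have hae := D.ae_nullEnergy_sub hR₀ hU hA hσ b h1 h2
  have hint := integral_congr_ae hae
  rw [integral_sub ((hE R₂ (h1.trans h2)).comp_sub_right ((σ * R₂ : ℝ) : S1))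
      ((hE R₁ h1).comp_sub_right ((σ * R₁ : ℝ) : S1)),
    integral_sub_right_eq_self (fun θ => nullEnergy σ b R₂ (D.u R₂ θ) (D.ur R₂ θ) (D.ut R₂ θ)
      (D.ar R₂ θ) (D.at' R₂ θ)), integral_sub_right_eq_self (fun θ => nullEnergy σ b R₁ (D.u R₁ θ)
        (D.ur R₁ θ) (D.ut R₁ θ) (D.ar R₁ θ) (D.at' R₁ θ)), integral_neg] at hint
  rw [← D.integral_eq (fun R _ u ur ut ar at' => nullEnergy σ b R u ur ut ar at') (h1.trans h2),
    ← D.integral_eq (fun R _ u ur ut ar at' => nullEnergy σ b R u ur ut ar at') h1, hint]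
  congr 1
  simp only [intervalIntegral.integral_of_le h2]
  -- exchange the integrals over `R` and over the characteristics, then undo the shear
  rw [← integral_integral_swap]
  · refine setIntegral_congr_fun measurableSet_Ioc fun R hR => ?_
    rw [integral_sub_right_eq_self (fun θ => nullLoss σ b R (D.u R θ) (D.ur R θ) (D.ut R θ)
      (D.ar R θ) (D.at' R θ)) ((σ * R : ℝ) : S1)]
    exact D.integral_eq (fun R _ u ur ut ar at' => nullLoss σ b R u ur ut ar at')
      (Ioc_subset_Ici_of_le h1 hR)
  · exact (measurePreserving_shear σ R₁ R₂).integrable_comp_of_integrable S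

/-- The part `(2/R) ∫ (U_R - b/R)²` of the loss of the effective energy that involves only `U`. -/
noncomputable def kineticLoss (b : ℝ) (U : Field R₀) (R : ℝ) : ℝ :=
  2 / R * ∫ θ : S1, (U.dR R θ - b * R⁻¹) ^ 2

lemma integrable_sq_dR_sub (U : Field R₀) (b R : ℝ) :
    Integrable (fun θ => (U.dR R θ - b * R⁻¹) ^ 2) volume :=
  ((Lp.memLp (U.dR R)).sub (memLp_const (b * R⁻¹))).integrable_sq

lemma integrable_effectiveDensity (hR₀ : 0 < R₀) (U A : Field R₀) (b : ℝ) {R : ℝ}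
    (hR : R ∈ Ici R₀) : Integrable (effectiveDensity b U A R) volume := by
  have F := finiteEnergy_circle hR₀ U A hR
  refine (((F.integrable_nullEnergy 1 b).add (F.integrable_nullEnergy (-1) b)).div_const 2).congr
    (Eventually.of_forall fun θ => ?_)
  simp only [Pi.add_apply, nullEnergy, effectiveDensity, densityA]
  ring

/-- The energy identity: half the sum of the identities in the two null directions. -/
lemma effectiveEnergy_sub (hR₀ : 0 < R₀) {U A : Field R₀} (hU : WeakEquationU U A)
    (hA : WeakEquationA U A) (b : ℝ) {R₁ R₂ : ℝ} (h1 : R₀ ≤ R₁) (h2 : R₁ ≤ R₂) :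
    IntervalIntegrable (fun R => kineticLoss b U R + dissipation b U A R) volume R₁ R₂ ∧
    IntervalIntegrable (dissipation b U A) volume R₁ R₂ ∧
    effectiveEnergy b U A R₁ - effectiveEnergy b U A R₂ =
      ∫ R in R₁..R₂, (kineticLoss b U R + dissipation b U A R) := by
  obtain ⟨i₁, e₁⟩ := integral_nullEnergy_sub hR₀ hU hA (σ := 1) (by norm_num) b h1 h2
  obtain ⟨i₂, e₂⟩ := integral_nullEnergy_sub hR₀ hU hA (σ := -1) (by norm_num) b h1 h2
  have hE : ∀ R ∈ Ici R₀, effectiveEnergy b U A R =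
      ((∫ θ, nullEnergy 1 b R (U.val R θ) (U.dR R θ) (U.dθ R θ) (A.dR R θ) (A.dθ R θ)) +
      ∫ θ, nullEnergy (-1) b R (U.val R θ) (U.dR R θ) (U.dθ R θ) (A.dR R θ) (A.dθ R θ)) / 2 := by
    intro R hR
    have F := finiteEnergy_circle hR₀ U A hR
    rw [← integral_add (F.integrable_nullEnergy 1 b) (F.integrable_nullEnergy (-1) b),
      ← integral_div]
    refine integral_congr_ae (Eventually.of_forall fun θ => ?_)
    simp only [nullEnergy, effectiveDensity, densityA]
    ring
  have hL : ∀ R ∈ Ici R₀, kineticLoss b U R + dissipation b U A R =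
      ((∫ θ, nullLoss 1 b R (U.val R θ) (U.dR R θ) (U.dθ R θ) (A.dR R θ) (A.dθ R θ)) +
      ∫ θ, nullLoss (-1) b R (U.val R θ) (U.dR R θ) (U.dθ R θ) (A.dR R θ) (A.dθ R θ)) / 2 := by
    intro R hR
    have F := finiteEnergy_circle hR₀ U A hR
    have q : Integrable (fun θ => exp (4 * U.val R θ) / (4 * R ^ 2) *
        (2 * b * (A.dR R θ) ^ 2 + (1 - 2 * b) * (A.dθ R θ) ^ 2)) volume := by
      simpa using F.integrable_weighted_quadratic (2 * b) (1 - 2 * b) 0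
    rw [← integral_add (F.integrable_nullLoss 1 b) (F.integrable_nullLoss (-1) b), ← integral_div,
      kineticLoss, dissipation, ← mul_add,
      ← integral_add (integrable_sq_dR_sub U b R) q, ← integral_const_mul]
    refine integral_congr_ae (Eventually.of_forall fun θ => ?_)
    simp only [nullLoss]
    ring
  have hmem : ∀ R ∈ uIoc R₁ R₂, R ∈ Ici R₀ := fun R hR => by
    rw [uIoc_of_le h2] at hR; exact Ioc_subset_Ici_of_le h1 hR
  refine ⟨((i₁.add i₂).div_const 2).congr fun R hR => (hL R (hmem R hR)).symm, ?_, ?_⟩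
  · obtain ⟨D⟩ := nonempty_versions U A
    have := D.integrableOn_integral (R₂ := R₂) (fun R _ u _ _ ar at' => 2 / R *
      (exp (4 * u) / (4 * R ^ 2) * (2 * b * ar ^ 2 + (1 - 2 * b) * at' ^ 2))) h1
      ((D.finiteEnergy_slab hR₀ h1 R₂).integrable_dissipation b)
    simp only [integral_const_mul] at this
    exact (intervalIntegrable_iff_integrableOn_Ioc_of_le h2).2 this
  · have : ∫ R in R₁..R₂, (kineticLoss b U R + dissipation b U A R) =
        ∫ R in R₁..R₂, ((∫ θ, nullLoss 1 b R (U.val R θ) (U.dR R θ) (U.dθ R θ) (A.dR R θ)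
          (A.dθ R θ)) + ∫ θ, nullLoss (-1) b R (U.val R θ) (U.dR R θ) (U.dθ R θ) (A.dR R θ)
          (A.dθ R θ)) / 2 :=
      intervalIntegral.integral_congr_ae (Eventually.of_forall fun R hR => hL R (hmem R hR))
    rw [this, intervalIntegral.integral_div, intervalIntegral.integral_add i₁ i₂, hE R₁ h1,
      hE R₂ (h1.trans h2)]
    linarith

lemma dissipation_nonneg {b : ℝ} (hb : b ∈ Icc (0 : ℝ) (1 / 2)) (U A : Field R₀) {R : ℝ}
    (hR : 0 ≤ R) : 0 ≤ dissipation b U A R := by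
  refine mul_nonneg (by positivity) (integral_nonneg fun θ => ?_)
  have h1 : 0 ≤ 1 - 2 * b := by linarith [hb.2]
  have h2 := hb.1
  positivity

lemma kineticLoss_nonneg (b : ℝ) (U : Field R₀) {R : ℝ} (hR : 0 ≤ R) :
    0 ≤ kineticLoss b U R :=
  mul_nonneg (by positivity) (integral_nonneg fun θ => sq_nonneg _)

lemma effectiveEnergy_nonneg (b : ℝ) (U A : Field R₀) (R : ℝ) :
    0 ≤ effectiveEnergy b U A R := by
  refine integral_nonneg fun θ => ?_
  simp only [effectiveDensity, densityA, Pi.zero_apply]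
  positivity

lemma antitoneOn_effectiveEnergy (hR₀ : 0 < R₀) {U A : Field R₀} (hU : WeakEquationU U A)
    (hA : WeakEquationA U A) {b : ℝ} (hb : b ∈ Icc (0 : ℝ) (1 / 2)) :
    AntitoneOn (effectiveEnergy b U A) (Ici R₀) := by
  intro R₁ h1 R₂ _ h2
  have e := (effectiveEnergy_sub hR₀ hU hA b h1 h2).2.2
  have : 0 ≤ ∫ R in R₁..R₂, (kineticLoss b U R + dissipation b U A R) := by
    refine intervalIntegral.integral_nonneg h2 fun R hR => ?_
    have hR' : 0 ≤ R := hR₀.le.trans (le_trans h1 hR.1)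
    exact add_nonneg (kineticLoss_nonneg b U hR') (dissipation_nonneg hb U A hR')
  linarith

lemma integral_dissipation_le (hR₀ : 0 < R₀) {U A : Field R₀} (hU : WeakEquationU U A)
    (hA : WeakEquationA U A) (b : ℝ) {R : ℝ} (hR : R₀ ≤ R) :
    ∫ r in R₀..R, dissipation b U A r ≤ effectiveEnergy b U A R₀ := by
  obtain ⟨i₁, i₂, e⟩ := effectiveEnergy_sub hR₀ hU hA b le_rfl hR
  have h := intervalIntegral.integral_mono_on hR i₂ i₁ fun r hr =>
    le_add_of_nonneg_left (kineticLoss_nonneg b U (hR₀.le.trans hr.1))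
  linarith [effectiveEnergy_nonneg b U A R]

lemma integrableOn_dissipation (hR₀ : 0 < R₀) {U A : Field R₀} (hU : WeakEquationU U A)
    (hA : WeakEquationA U A) {b : ℝ} (hb : b ∈ Icc (0 : ℝ) (1 / 2)) :
    IntegrableOn (dissipation b U A) (Ioi R₀) volume := by
  refine integrableOn_Ioi_of_intervalIntegral_norm_bounded (effectiveEnergy b U A R₀) R₀
    (fun n : ℝ => ?_) tendsto_id ?_
  · rcases le_total R₀ n with h | h
    · exact (intervalIntegrable_iff_integrableOn_Ioc_of_le h).1
        (effectiveEnergy_sub hR₀ hU hA b le_rfl h).2.1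
    · rw [id, Ioc_eq_empty (not_lt.2 h)]; exact integrableOn_empty
  · filter_upwards [eventually_ge_atTop R₀] with n hn
    refine le_trans (le_of_eq ?_) (integral_dissipation_le hR₀ hU hA b hn)
    refine intervalIntegral.integral_congr fun r hr => ?_
    rw [id, uIcc_of_le hn] at hr
    exact Real.norm_of_nonneg (dissipation_nonneg hb U A (hR₀.le.trans hr.1))

end Gowdy

theorem mainTheorem3 (R₀ : ℝ) (hR₀ : 0 < R₀) (U A : Gowdy.Field R₀)
    (hU : Gowdy.WeakEquationU U A) (hA : Gowdy.WeakEquationA U A) :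
    (∀ b ∈ Icc (0 : ℝ) (1 / 2),
      (∀ R ∈ Ici R₀, Integrable (Gowdy.effectiveDensity b U A R) volume) ∧
      AntitoneOn (Gowdy.effectiveEnergy b U A) (Ici R₀) ∧
      IntegrableOn (Gowdy.dissipation b U A) (Ioi R₀) volume ∧
      ∫ R in Ioi R₀, Gowdy.dissipation b U A R
        ≤ Gowdy.effectiveEnergy b U A R₀ + b ^ 2 * Gowdy.energy U A R₀) ∧
    IntegrableOn (fun R => Gowdy.energyA U A R / R) (Ioi R₀) volume := by
  refine ⟨fun b hb => ⟨fun R hR => Gowdy.integrable_effectiveDensity hR₀ U A b hR,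
    Gowdy.antitoneOn_effectiveEnergy hR₀ hU hA hb, Gowdy.integrableOn_dissipation hR₀ hU hA hb,
    ?_⟩, ?_⟩
  · have hE : 0 ≤ Gowdy.energy U A R₀ := by
      refine integral_nonneg fun θ => ?_
      simp only [Gowdy.densityA, Pi.zero_apply]
      positivity
    have hlim := intervalIntegral_tendsto_integral_Ioi R₀
      (Gowdy.integrableOn_dissipation hR₀ hU hA hb) Filter.tendsto_id
    have hle : ∫ R in Ioi R₀, Gowdy.dissipation b U A R ≤ Gowdy.effectiveEnergy b U A R₀ := by
      refine le_of_tendsto hlim ?_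
      filter_upwards [Filter.eventually_ge_atTop R₀] with R hR
      exact Gowdy.integral_dissipation_le hR₀ hU hA b hR
    have := mul_nonneg (sq_nonneg b) hE
    linarith
  · -- for `b = 1/4` the dissipation is `E^A / R`
    refine (Gowdy.integrableOn_dissipation hR₀ hU hA (b := 1 / 4)
      ⟨by norm_num, by norm_num⟩).congr_fun (fun R _ => ?_) measurableSet_Ioi
    simp only [Gowdy.dissipation, Gowdy.energyA, Gowdy.densityA]
    have h : ∫ θ, exp (4 * U.val R θ) / (4 * R ^ 2) *
          (2 * (1 / 4) * (A.dR R θ) ^ 2 + (1 - 2 * (1 / 4)) * (A.dθ R θ) ^ 2) =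
        1 / 2 * ∫ θ, exp (4 * U.val R θ) / (4 * R ^ 2) * ((A.dR R θ) ^ 2 + (A.dθ R θ) ^ 2) := by
      rw [← integral_const_mul]
      congr 1; funext θ; ring
    rw [h]
    ring
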